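/- Let $(X,\mathcal B,\mu)$ be a probability space, $T\colon X\to X$ an invertible (bi-measurable) $\mu$-preserving transformation, $\gamma\in\mathbb R\setminus\mathbb Q$, and $f\in L^2(\mu)$ (complex valued). Write $[t]$ and $\{t\}$ for the integer part (floor) and the fractional part of $t\in\mathbb R$. Let $R$ be the equivalence relation on $[0,1]\times X$ generated by $(1,x)\sim(0,Tx)$, $x\in X$; let $Y=([0,1]\times X)/R$ with the quotient $\sigma$-algebra, and let $\nu$ be the image on $Y$ of (Lebesgue measure)$\,\times\mu$. For $t\in\mathbb R$, $x\in X$ write $(t,x)$ for the class of $(\{t\},T^{[t]}x)$ in $Y$, let $S\colon Y\to Y$, $S(t,x)=(t+\gamma,x)$, let $\mathcal I(S)$ be the $\sigma$-algebra of measurable $S$-invariant subsets of $Y$, and let $\tilde f(t,x)=f(x)$ for $t\in[0,1)$, $x\in X$. For $m\in\mathbb Z$ let $\mathbb E(f\mid\mathcal I_{\gamma,m}(T))$ be the orthogonal projection of $f$ to the closed subspace $\{g\in L^2(\mu): g\circ T=e^{2\pi i m/\gamma}g\}$ of $L^2(\mu)$, and let $$c_m=\int_0^1e^{-2\pi i mt/\gamma}\,dt=\frac{\exp(-2\pi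 i\frac m\gamma)-1}{-2\pi i\frac m\gamma}\quad(m\ne0),\qquad c_0=1.$$ Let $F(y)=\lim_{N\to\infty}\frac1N\sum_{n=0}^{N-1}\tilde f(S^ny)$ at the points $y\in Y$ where this limit exists, and let $F$ be a fixed constant at all other points. Then the limit exists for $\nu$-a.e. $y$, and $F$ is a version of $\mathbb E(\tilde f\mid\mathcal I(S))$, that is, $F=\mathbb E(\tilde f\mid\mathcal I(S))$ $\nu$-a.e. (and $F$ is itself $\mathcal I(S)$-measurable if $f$ is a measurable function, rather than only $\mu$-a.e. equal to one). Moreover, with this version of the conditional expectation, for every $\ell\in\mathbb R$ and for $\mu$-a.e. $x\in X$ (the exceptional null set may depend on $\ell$) the limit defining $F$ exists at the point $(\{\ell\},T^{[\ell]}x)$, the series below converges unconditionally, and $$\mathbb E\big(\tilde f\mid\mathcal I(S)\big)\big(\{\ell\},T^{[\ell]}x\big)=\sum_{m\in\mathbb Z}\exp\Big(2\pi i\frac{m\ell}\gamma\Big)\,c_m\,\mathbb E(f\mid\mathcal I_{\gamma,m}(T))(x)=\lim_{N\to\infty}\frac1N\sum_{n=0}^{N-1}f\big(T^{[\gamma n+\ell]}x\big).$$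 In particular $\frac1N\sum_{n=0}^{N-1}T^{[\gamma n+\ell]}f(x)$ converges for $\mu$-a.e. $x$. -/

import Mathlib

open MeasureTheory Filter Topology

noncomputable section

namespace IrrationalAverages

section Suspension

variable {X : Type*} [MeasurableSpace X]

/-- The `k`-th power of the invertible transformation `T`, for `k : ℤ`. -/
def intIter (T : X ≃ᵐ X) (k : ℤ) : X → X := ((T.toEquiv : Equiv.Perm X) ^ k : Equiv.Perm X)

lemma intIter_add_one (T : X ≃ᵐ X) (k : ℤ) (x : X) : intIter T (k + 1) x = intIter T k (T x) := by
  simp only [intIter, _root_.zpow_add_one, Equiv.Perm.mul_apply]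
  rfl

/-- The relation `(1, x) ~ (0, T x)` on `[0,1] × X`. -/
def SuspRel (T : X ≃ᵐ X) (p q : unitInterval × X) : Prop :=
  ∃ x : X, p = (1, x) ∧ q = (0, T x)

/-- The suspension `Y` of `(X, T)`: the quotient of `[0,1] × X` by the equivalence relation
generated by `(1, x) ~ (0, T x)`. -/
def Susp (T : X ≃ᵐ X) : Type _ := Quot (SuspRel T)

/-- The quotient σ-algebra on `Y`. -/
instance (T : X ≃ᵐ X) : MeasurableSpace (Susp T) :=
  inferInstanceAs (MeasurableSpace (Quot (SuspRel T)))

/-- The measure on `Y`: the image of (Lebesgue measure on `[0,1]`) `× μ`. -/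
def suspMeasure (T : X ≃ᵐ X) (μ : Measure X) : Measure (Susp T) :=
  ((volume : Measure unitInterval).prod μ).map (Quot.mk (SuspRel T))

/-- The point of `Y` written `(t, x)` for real `t`, that is, the class of
`({t}, T^[t] x)`. -/
def suspPoint (T : X ≃ᵐ X) (t : ℝ) (x : X) : Susp T :=
  Quot.mk _ (⟨Int.fract t, Int.fract_nonneg t, (Int.fract_lt_one t).le⟩, intIter T ⌊t⌋ x)

lemma suspPoint_one_add (T : X ≃ᵐ X) (s : ℝ) (x : X) :
    suspPoint T (1 + s) x = suspPoint T s (T x) := by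
  simp only [suspPoint, add_comm (1 : ℝ) s, Int.fract_add_one, Int.floor_add_one,
    intIter_add_one]
  rfl

/-- The step `S(t, x) = (t + γ, x)` on `Y`. -/
def suspShift (T : X ≃ᵐ X) (γ : ℝ) : Susp T → Susp T :=
  Quot.lift (fun p : unitInterval × X => suspPoint T ((p.1 : ℝ) + γ) p.2) (by
    rintro _ _ ⟨x, rfl, rfl⟩
    simpa using suspPoint_one_add T γ x)

/-- The extension of `f : X → ℂ` to `Y`: on the class of `(t, x)` with `0 ≤ t < 1` it is
`f x` (and on that of `(1, x) ~ (0, T x)` it is `f (T x)`). -/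
def suspExt (T : X ≃ᵐ X) (f : X → ℂ) : Susp T → ℂ :=
  Quot.lift (fun p : unitInterval × X => if (p.1 : ℝ) < 1 then f p.2 else f (T p.2)) (by
    rintro _ _ ⟨x, rfl, rfl⟩
    simp)

/-- The pointwise limit of the averages `(1/N) ∑_{n < N} f̃ (S^n y)`
(with a fixed junk value at the points `y` where they diverge). -/
def suspLimit (T : X ≃ᵐ X) (γ : ℝ) (f : X → ℂ) (y : Susp T) : ℂ :=
  limUnder atTop fun N : ℕ => birkhoffAverage ℂ (suspShift T γ) (suspExt T f) N y

end Suspension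

section Eigenspace

variable {X : Type*} [MeasurableSpace X] {μ : Measure X} {T : X ≃ᵐ X}

/-- The operator `g ↦ g ∘ T` on `L²(μ)`. -/
def koopman (hT : MeasurePreserving T μ μ) : Lp ℂ 2 μ →L[ℂ] Lp ℂ 2 μ :=
  (Lp.compMeasurePreservingₗᵢ ℂ T hT).toContinuousLinearMap

/-- The closed subspace of all `g` in `L²(μ)` with `g ∘ T = exp(2πi m/γ) g`. -/
def eigenspace (hT : MeasurePreserving T μ μ) (γ : ℝ) (m : ℤ) : Submodule ℂ (Lp ℂ 2 μ) :=
  Module.End.eigenspace (koopman hT : Module.End ℂ (Lp ℂ 2 μ))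
    (Complex.exp (2 * Real.pi * Complex.I * (m / γ)))

instance (hT : MeasurePreserving T μ μ) (γ : ℝ) (m : ℤ) :
    CompleteSpace (eigenspace hT γ m) :=
  (ContinuousLinearMap.isClosed_eigenspace (koopman hT) _).completeSpace_coe

/-- The orthogonal projection of `f` to the eigenspace for `exp(2πi m/γ)`. -/
def eigenProj (hT : MeasurePreserving T μ μ) (γ : ℝ) (m : ℤ) (f : Lp ℂ 2 μ) : Lp ℂ 2 μ :=
  (eigenspace hT γ m).starProjection f

end Eigenspace

/-- The number `∫₀¹ exp(-2πi m t/γ) dt = (exp(-2πi m/γ) - 1) / (-2πi m/γ)`,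
which is `1` for `m = 0`. -/
def eigenCoeff (γ : ℝ) (m : ℤ) : ℂ :=
  if m = 0 then 1
  else (Complex.exp (-(2 * Real.pi * Complex.I * (m / γ))) - 1) /
    (-(2 * Real.pi * Complex.I * (m / γ)))

end IrrationalAverages

end

open IrrationalAverages

/-! The maximal ergodic lemma gives Birkhoff's theorem for `S` on the suspension, so the averages of
`f̃` converge almost everywhere to the conditional expectation. By Fubini, for almost every `x` the
averages started at `(t, x)` converge for a dense set of real `t`.

To reach every `t`, move the start from `ℓ` to a slightly larger `s`. The index `⌊γ n + ℓ⌋` changes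
only when `γ n + ℓ` is just below an integer. Irrationality of `γ` makes such `n` far apart, hence
of small density. Birkhoff's theorem for `|f|²` under `T` and `T⁻¹` bounds the square means of `f`
along the two-sided orbit, and Cauchy–Schwarz then makes the change negligible
(`eventually_norm_floorAvg_sub_le`). So for almost every `x` the limit `F(t, x)` exists at every `t`
and is continuous in `t` (`ae_tendsto_floorAvg`); the exceptional set does not depend on `t`.

Invariance of `F` under `S` says that `t ↦ F(t, x)` has period `γ`, so it has a Fourier series with
period `p = |γ|`. Since `F(t + 1, x) = F(t, T x)`, each coefficient, as a function of `x`, is an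
eigenfunction of `T`. To identify it, pair it with an eigenfunction `g`. The function `exp(2πi m
t/p) g(x)` on the suspension is `S`-invariant, so in the pairing `F` may be replaced by `f̃`, and
the integral over `t` produces `c_m`. Thus the coefficient is `c_m` times the projection of `f`
(`waveCoeff_ae_eq`).

Finally `∑ |c_m|²` is finite because `c_m = O(1/|m|)`. The eigenspaces are orthogonal, so by Bessel
the squares of the projections are summable at almost every `x`. The Fourier coefficients are
therefore absolutely summable, and a continuous function with this property is the sum of its
Fourier series at every point (`hasSum_wave_of_summable`). -/

open scoped ComplexConjugate

namespace IrrationalAverages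

/-! ### The maximal ergodic lemma and Birkhoff's theorem. -/

section Birkhoff

variable {α : Type*} {S : α → α}

/-- The maximum of the Birkhoff sums of `φ` of length at most `n` (including the empty sum). -/
noncomputable def maxSum (S : α → α) (φ : α → ℝ) : ℕ → α → ℝ
  | 0 => fun _ => 0
  | n + 1 => fun x => max 0 (φ x + maxSum S φ n (S x))

lemma maxSum_succ (φ : α → ℝ) (n : ℕ) (x : α) :
    maxSum S φ (n + 1) x = max 0 (φ x + maxSum S φ n (S x)) := rfl

lemma maxSum_nonneg (φ : α → ℝ) (n : ℕ) (x : α) : 0 ≤ maxSum S φ n x := by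
  cases n with
  | zero => exact le_rfl
  | succ n => exact le_max_left _ _

lemma maxSum_mono (φ : α → ℝ) (x : α) : Monotone fun n => maxSum S φ n x := by
  refine monotone_nat_of_le_succ fun n => ?_
  induction n generalizing x with
  | zero => exact maxSum_nonneg φ 1 x
  | succ n ih =>
    rw [maxSum_succ, maxSum_succ φ (n + 1)]
    exact max_le_max le_rfl (add_le_add le_rfl (ih (S x)))

lemma birkhoffSum_le_maxSum (φ : α → ℝ) (n : ℕ) (x : α) :
    birkhoffSum S φ n x ≤ maxSum S φ n x := by
  induction n generalizing x with
  | zero => simp [maxSum]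
  | succ n ih =>
    rw [birkhoffSum_succ', maxSum_succ]
    exact le_max_of_le_right (add_le_add le_rfl (ih _))

/-- The set on which the Birkhoff sums of `φ` are unbounded from above. -/
def unboundedSet (S : α → α) (φ : α → ℝ) : Set α :=
  {x | Tendsto (fun n => maxSum S φ n x) atTop atTop}

/-- In the recursion for `maxSum` the maximum with `0` is inactive once the value is positive, so
the sequences at `x` and at `S x` eventually differ by the constant `φ x` and a shift of the index.
-/
lemma preimage_unboundedSet (φ : α → ℝ) : S ⁻¹' unboundedSet S φ = unboundedSet S φ := by
  ext x
  simp only [unboundedSet, Set.mem_preimage, Set.mem_ofPred_eq]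
  rw [← tendsto_add_atTop_iff_nat (f := fun n => maxSum S φ n x) 1]
  simp only [maxSum_succ]
  constructor
  · intro h
    exact tendsto_atTop_mono (fun n => le_max_right _ _) (tendsto_atTop_add_const_left _ (φ x) h)
  · intro h
    have h2 := tendsto_atTop_add_const_left _ (-φ x) h
    refine tendsto_atTop_mono' _ ?_ h2
    filter_upwards [h.eventually_gt_atTop 0] with n hn
    have : (0 : ℝ) < φ x + maxSum S φ n (S x) := by
      simpa using hn
    rw [max_eq_right this.le]
    simp

variable [MeasurableSpace α] {μ : Measure α}

lemma measurable_maxSum (hS : Measurable S) {φ : α → ℝ} (hφ : Measurable φ) (n : ℕ) :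
    Measurable (maxSum S φ n) := by
  induction n with
  | zero => exact measurable_const
  | succ n ih => exact measurable_const.max (hφ.add (ih.comp hS))

lemma integrable_maxSum (hS : MeasurePreserving S μ μ) {φ : α → ℝ}
    (hφ : Integrable φ μ) (n : ℕ) : Integrable (maxSum S φ n) μ := by
  induction n with
  | zero => exact integrable_zero _ _ _
  | succ n ih => exact (integrable_zero _ _ _).sup (hφ.add (hS.integrable_comp_of_integrable ih))

lemma measurableSet_unboundedSet (hS : Measurable S) {φ : α → ℝ} (hφ : Measurable φ) :
    MeasurableSet (unboundedSet S φ) := by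
  have : unboundedSet S φ = ⋂ k : ℕ, ⋃ n : ℕ, {x | (k : ℝ) ≤ maxSum S φ n x} := by
    ext x
    simp only [unboundedSet, Set.mem_ofPred_eq, Set.mem_iInter, Set.mem_iUnion]
    constructor
    · intro h k
      exact (h.eventually_ge_atTop (k : ℝ)).exists
    · intro h
      refine tendsto_atTop_atTop_of_monotone (maxSum_mono φ x) fun b => ?_
      obtain ⟨k, hk⟩ := exists_nat_ge b
      obtain ⟨n, hn⟩ := h k
      exact ⟨n, hk.trans hn⟩
  rw [this]
  exact MeasurableSet.iInter fun k => MeasurableSet.iUnion fun n =>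
    measurableSet_le measurable_const (measurable_maxSum hS hφ n)

/-- The maximal ergodic lemma. -/
lemma setIntegral_unboundedSet_nonneg (hS : MeasurePreserving S μ μ) {φ : α → ℝ}
    (hφm : Measurable φ) (hφ : Integrable φ μ) : 0 ≤ ∫ x in unboundedSet S φ, φ x ∂μ := by
  set A := unboundedSet S φ
  have hA : MeasurableSet A := measurableSet_unboundedSet hS.measurable hφm
  have hSA : MeasurePreserving S (μ.restrict A) (μ.restrict A) := by
    have := hS.restrict_preimage hA
    rwa [preimage_unboundedSet] at this
  -- The integrand is always at most `|φ|` in absolute value, and on `A` it is eventually equal to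
  -- `φ`.
  have hlim : Tendsto (fun n => ∫ x in A, (maxSum S φ (n + 1) x - maxSum S φ n (S x)) ∂μ) atTop
      (𝓝 (∫ x in A, φ x ∂μ)) := by
    refine tendsto_integral_of_dominated_convergence (fun x => |φ x|) ?_ hφ.abs.integrableOn ?_ ?_
    · intro n
      exact ((measurable_maxSum hS.measurable hφm _).sub
        ((measurable_maxSum hS.measurable hφm _).comp hS.measurable)).aestronglyMeasurable
    · intro n
      refine Eventually.of_forall fun x => ?_
      rw [maxSum_succ, Real.norm_eq_abs]
      have h0 := maxSum_nonneg (S := S) φ n (S x)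
      rcases max_cases 0 (φ x + maxSum S φ n (S x)) with ⟨h1, h2⟩ | ⟨h1, h2⟩ <;> rw [h1]
      · rw [zero_sub, abs_neg, abs_of_nonneg h0]
        have := neg_abs_le (φ x)
        linarith
      · rw [add_sub_cancel_right]
    · refine (ae_restrict_mem hA).mono fun x hx => ?_
      have hx' : Tendsto (fun n => maxSum S φ n (S x)) atTop atTop := by
        have : x ∈ S ⁻¹' A := by rw [preimage_unboundedSet]; exact hx
        exact this
      refine tendsto_const_nhds.congr' ?_
      filter_upwards [hx'.eventually_ge_atTop (-φ x)] with n hn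
      rw [maxSum_succ, max_eq_right (by linarith), add_sub_cancel_right]
  -- Invariance of the measure on `A` removes `S`, leaving the integral of a nonnegative increment.
  refine ge_of_tendsto' hlim fun n => ?_
  have hi := fun k => (integrable_maxSum hS hφ k).integrableOn (s := A)
  have hcomp : ∫ x in A, maxSum S φ n (S x) ∂μ = ∫ x in A, maxSum S φ n x ∂μ := by
    conv_rhs => rw [← hSA.map_eq]
    rw [integral_map hSA.measurable.aemeasurable
      (measurable_maxSum hS.measurable hφm n).aestronglyMeasurable]
  have hsub : ∫ x in A, (maxSum S φ (n + 1) x - maxSum S φ n (S x)) ∂μ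
      = ∫ x in A, maxSum S φ (n + 1) x ∂μ - ∫ x in A, maxSum S φ n (S x) ∂μ :=
    integral_sub (hi _) (hSA.integrable_comp_of_integrable (hi n))
  rw [hsub, hcomp, ← integral_sub (hi _) (hi _)]
  exact integral_nonneg fun x => sub_nonneg.2 (maxSum_mono φ x n.le_succ)

variable [IsFiniteMeasure μ]

/-- Apply the maximal ergodic lemma to `g - E - ε`, with `E` the conditional expectation. The set
`A` of unbounded sums is invariant, so the integral over it is `-ε μ(A)`; as this is nonnegative,
`A` is null. -/
lemma ae_birkhoffSum_le (hS : MeasurePreserving S μ μ) {g : α → ℝ} (hgm : Measurable g)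
    (hg : Integrable g μ) {ε : ℝ} (hε : 0 < ε) :
    ∀ᵐ x ∂μ, ∃ C : ℝ, ∀ n : ℕ,
      birkhoffSum S g n x ≤ n * ((μ[g | MeasurableSpace.invariants S]) x + ε) + C := by
  have hm : MeasurableSpace.invariants S ≤ ‹MeasurableSpace α› := MeasurableSpace.invariants_le S
  set E := μ[g | MeasurableSpace.invariants S]
  have hEI : Measurable[MeasurableSpace.invariants S] E := stronglyMeasurable_condExp.measurable
  have hE : Measurable E := hEI.mono hm le_rfl
  have hES : E ∘ S = E := MeasurableSpace.comp_eq_of_measurable_invariants hEI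
  set φ : α → ℝ := fun x => g x - (E x + ε)
  have hφm : Measurable φ := hgm.sub (hE.add_const ε)
  have hφ : Integrable φ μ := hg.sub (integrable_condExp.add (integrable_const ε))
  set A := unboundedSet S φ
  have hA : MeasurableSet A := measurableSet_unboundedSet hS.measurable hφm
  have hAI : MeasurableSet[MeasurableSpace.invariants S] A := ⟨hA, preimage_unboundedSet φ⟩
  have hint : ∫ x in A, φ x ∂μ = -(μ.real A * ε) := by
    have h1 : ∫ x in A, φ x ∂μ = ∫ x in A, g x ∂μ - ∫ x in A, (E x + ε) ∂μ :=
      integral_sub hg.integrableOn (integrable_condExp.add (integrable_const ε)).integrableOn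
    rw [h1, integral_add integrable_condExp.integrableOn (integrable_const ε),
      setIntegral_condExp hm hg hAI]
    simp
  have h0 := setIntegral_unboundedSet_nonneg hS hφm hφ
  have hμA : μ A = 0 := by
    have h2 : μ.real A * ε ≤ 0 := by
      have : 0 ≤ -(μ.real A * ε) := hint ▸ h0
      linarith
    have h3 : μ.real A = 0 := le_antisymm (by nlinarith) measureReal_nonneg
    exact (measureReal_eq_zero_iff).1 h3
  have hae : ∀ᵐ x ∂μ, x ∉ A := measure_eq_zero_iff_ae_notMem.1 hμA
  filter_upwards [hae] with x hx
  obtain ⟨C, hC⟩ : ∃ C, ∀ n, maxSum S φ n x ≤ C := by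
    by_contra! h
    exact hx (tendsto_atTop_atTop_of_monotone (maxSum_mono φ x)
      fun b => (h b).imp fun n hn => hn.le)
  refine ⟨C, fun n => ?_⟩
  have h1 := (birkhoffSum_le_maxSum φ n x).trans (hC n)
  have h2 : birkhoffSum S φ n x = birkhoffSum S g n x - n * (E x + ε) := by
    have : φ = g - (fun x => E x + ε) := rfl
    rw [this, birkhoffSum_sub, birkhoffSum_of_comp_eq (φ := fun x => E x + ε)]
    · simp [mul_add]
    · funext y
      have := congrFun hES y
      simpa using this
  linarith

lemma ae_eventually_birkhoffAverage_lt (hS : MeasurePreserving S μ μ) {g : α → ℝ}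
    (hgm : Measurable g) (hg : Integrable g μ) :
    ∀ᵐ x ∂μ, ∀ b, (μ[g | MeasurableSpace.invariants S]) x < b →
      ∀ᶠ n : ℕ in atTop, birkhoffAverage ℝ S g n x < b := by
  have h : ∀ᵐ x ∂μ, ∀ k : ℕ, ∃ C : ℝ, ∀ n : ℕ, birkhoffSum S g n x ≤
      n * ((μ[g | MeasurableSpace.invariants S]) x + 1 / ((k : ℝ) + 1)) + C :=
    ae_all_iff.2 fun k => ae_birkhoffSum_le hS hgm hg Nat.one_div_pos_of_nat
  filter_upwards [h] with x hx b hb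
  obtain ⟨k, hk⟩ := exists_nat_one_div_lt (sub_pos.2 hb)
  obtain ⟨C, hC⟩ := hx k
  have hlim : Tendsto (fun n : ℕ => ((μ[g | MeasurableSpace.invariants S]) x
      + 1 / ((k : ℝ) + 1)) + C / (n : ℝ)) atTop
      (𝓝 (((μ[g | MeasurableSpace.invariants S]) x + 1 / ((k : ℝ) + 1)) + 0)) :=
    tendsto_const_nhds.add (tendsto_const_div_atTop_nhds_zero_nat C)
  filter_upwards [hlim.eventually_lt_const (u := b) (by linarith), eventually_gt_atTop 0]
    with n hn hn0
  refine lt_of_le_of_lt ?_ hn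
  have hn0' : (0 : ℝ) < n := by exact_mod_cast hn0
  rw [birkhoffAverage, smul_eq_mul, inv_mul_le_iff₀ hn0', mul_add, mul_div_cancel₀ _ hn0'.ne']
  exact hC n

/-- **Birkhoff's pointwise ergodic theorem** for real functions. -/
theorem ae_tendsto_birkhoffAverage_real (hS : MeasurePreserving S μ μ) {g : α → ℝ}
    (hgm : Measurable g) (hg : Integrable g μ) :
    ∀ᵐ x ∂μ, Tendsto (fun n : ℕ => birkhoffAverage ℝ S g n x) atTop
      (𝓝 ((μ[g | MeasurableSpace.invariants S]) x)) := by
  filter_upwards [ae_eventually_birkhoffAverage_lt hS hgm hg,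
    ae_eventually_birkhoffAverage_lt hS hgm.neg hg.neg,
    condExp_neg (μ := μ) g (MeasurableSpace.invariants S)] with x h1 h2 h3
  refine tendsto_order.2 ⟨fun b hb => ?_, fun b hb => h1 b hb⟩
  have := h2 (-b) (by rw [h3]; simpa using hb)
  filter_upwards [this] with n hn
  rw [birkhoffAverage_neg] at hn
  simpa using hn

/-- **Birkhoff's pointwise ergodic theorem** for complex functions. -/
theorem ae_tendsto_birkhoffAverage (hS : MeasurePreserving S μ μ) {g : α → ℂ}
    (hgm : Measurable g) (hg : Integrable g μ) :
    ∀ᵐ x ∂μ, Tendsto (fun n : ℕ => birkhoffAverage ℂ S g n x) atTop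
      (𝓝 ((μ[g | MeasurableSpace.invariants S]) x)) := by
  filter_upwards [ae_tendsto_birkhoffAverage_real hS (Complex.measurable_re.comp hgm) hg.re,
    ae_tendsto_birkhoffAverage_real hS (Complex.measurable_im.comp hgm) hg.im,
    Complex.reCLM.comp_condExp_comm (m := MeasurableSpace.invariants S) hg,
    Complex.imCLM.comp_condExp_comm (m := MeasurableSpace.invariants S) hg] with x h1 h2 h3 h4
  have e1 : ∀ n, (birkhoffAverage ℂ S g n x).re = birkhoffAverage ℝ S (Complex.re ∘ g) n x :=
    fun n => by
      rw [birkhoffAverage_congr_ring ℂ ℝ]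
      exact map_birkhoffAverage ℝ ℝ Complex.reCLM S g n x
  have e2 : ∀ n, (birkhoffAverage ℂ S g n x).im = birkhoffAverage ℝ S (Complex.im ∘ g) n x :=
    fun n => by
      rw [birkhoffAverage_congr_ring ℂ ℝ]
      exact map_birkhoffAverage ℝ ℝ Complex.imCLM S g n x
  have h3' : ((μ[g | MeasurableSpace.invariants S]) x).re
      = (μ[Complex.re ∘ g | MeasurableSpace.invariants S]) x := h3
  have h4' : ((μ[g | MeasurableSpace.invariants S]) x).im
      = (μ[Complex.im ∘ g | MeasurableSpace.invariants S]) x := h4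
  have t1 : Tendsto (fun n => (birkhoffAverage ℂ S g n x).re) atTop
      (𝓝 ((μ[g | MeasurableSpace.invariants S]) x).re) := by
    simp only [e1, h3']; exact h1
  have t2 : Tendsto (fun n => (birkhoffAverage ℂ S g n x).im) atTop
      (𝓝 ((μ[g | MeasurableSpace.invariants S]) x).im) := by
    simp only [e2, h4']; exact h2
  have := (Complex.equivRealProdCLM.symm.continuous.tendsto _).comp (t1.prodMk_nhds t2)
  simpa [Function.comp_def, Complex.equivRealProdCLM_symm_apply] using this

end Birkhoff

/-! ### Coordinates, measure and flow on the suspension. -/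

section Suspension

variable {X : Type*} [MeasurableSpace X] (T : X ≃ᵐ X)

lemma intIter_zero (x : X) : intIter T 0 x = x := rfl

lemma intIter_add (j k : ℤ) (x : X) : intIter T (j + k) x = intIter T j (intIter T k x) := by
  simp only [intIter, _root_.zpow_add, Equiv.Perm.mul_apply]

lemma intIter_succ (k : ℤ) (x : X) : intIter T (k + 1) x = T (intIter T k x) := by
  rw [add_comm, intIter_add]; rfl

lemma intIter_natCast (n : ℕ) (x : X) : intIter T n x = T^[n] x := by
  induction n with
  | zero => rfl
  | succ n ih => rw [Nat.cast_succ, intIter_succ, ih, Function.iterate_succ_apply']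

lemma intIter_neg_natCast (n : ℕ) (x : X) : intIter T (-n) x = T.symm^[n] x := by
  induction n generalizing x with
  | zero => rfl
  | succ n ih =>
    rw [Function.iterate_succ_apply, ← ih, Nat.cast_succ, neg_add]
    rw [intIter_add]
    rfl

lemma measurable_intIter (k : ℤ) : Measurable (intIter T k) := by
  obtain ⟨n, rfl | rfl⟩ := k.eq_nat_or_neg
  · rw [show intIter T n = T^[n] from funext (intIter_natCast T n)]
    exact T.measurable.iterate n
  · rw [show intIter T (-n) = T.symm^[n] from funext (intIter_neg_natCast T n)]
    exact T.symm.measurable.iterate n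

lemma suspPoint_add_intCast (t : ℝ) (k : ℤ) (x : X) :
    suspPoint T (t + k) x = suspPoint T t (intIter T k x) := by
  simp only [suspPoint, Int.fract_add_intCast, Int.floor_add_intCast, intIter_add]
  rfl

lemma suspPoint_add_one (t : ℝ) (x : X) : suspPoint T (t + 1) x = suspPoint T t (T x) := by
  rw [add_comm, suspPoint_one_add]

/-- Only the endpoint `1` has content: there the gluing relation is used. -/
lemma mk_eq_suspPoint (p : unitInterval × X) :
    (Quot.mk _ p : Susp T) = suspPoint T (p.1 : ℝ) p.2 := by
  obtain ⟨⟨t, ht0, ht1⟩, x⟩ := p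
  rcases ht1.lt_or_eq with h | rfl
  · have h1 : ⌊t⌋ = 0 := Int.floor_eq_zero_iff.2 ⟨ht0, h⟩
    have h2 : Int.fract t = t := Int.fract_eq_self.2 ⟨ht0, h⟩
    simp only [suspPoint, h1, h2, intIter_zero]
  · have h3 : (Quot.mk (SuspRel T) ((1 : unitInterval), x) : Susp T)
        = Quot.mk _ ((0 : unitInterval), T x) := Quot.sound ⟨x, rfl, rfl⟩
    have h4 : suspPoint T (1 : ℝ) x = Quot.mk _ ((0 : unitInterval), T x) := by
      have := suspPoint_one_add T 0 x
      rw [add_zero] at this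
      rw [this]
      simp only [suspPoint, Int.floor_zero, intIter_zero, Int.fract_zero]
      rfl
    exact h3.trans h4.symm

lemma exists_suspPoint_eq (y : Susp T) : ∃ (t : ℝ) (x : X), y = suspPoint T t x := by
  induction y using Quot.ind with
  | mk p => exact ⟨p.1, p.2, mk_eq_suspPoint T p⟩

lemma suspShift_suspPoint (γ t : ℝ) (x : X) :
    suspShift T γ (suspPoint T t x) = suspPoint T (t + γ) x := by
  have h : suspShift T γ (suspPoint T t x)
      = suspPoint T (Int.fract t + γ) (intIter T ⌊t⌋ x) := rfl
  rw [h, ← suspPoint_add_intCast, add_right_comm, Int.fract_add_floor]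

lemma iterate_suspShift_suspPoint (γ t : ℝ) (n : ℕ) (x : X) :
    (suspShift T γ)^[n] (suspPoint T t x) = suspPoint T (γ * n + t) x := by
  induction n with
  | zero => simp
  | succ n ih =>
    rw [Function.iterate_succ_apply', ih, suspShift_suspPoint, Nat.cast_succ]
    congr 1; ring

lemma suspExt_suspPoint (f : X → ℂ) (t : ℝ) (x : X) :
    suspExt T f (suspPoint T t x) = f (intIter T ⌊t⌋ x) := if_pos (Int.fract_lt_one t)

lemma birkhoffAverage_suspPoint (γ : ℝ) (f : X → ℂ) (t : ℝ) (N : ℕ) (x : X) :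
    birkhoffAverage ℂ (suspShift T γ) (suspExt T f) N (suspPoint T t x)
      = (1 / (N : ℂ)) * ∑ n ∈ Finset.range N, f (intIter T ⌊γ * n + t⌋ x) := by
  simp only [birkhoffAverage, birkhoffSum, iterate_suspShift_suspPoint, suspExt_suspPoint,
    smul_eq_mul, one_div]

lemma measurable_suspMk : Measurable (Quot.mk (SuspRel T) : unitInterval × X → Susp T) :=
  measurable_quot_mk

lemma measurable_of_comp_suspMk {β : Type*} [MeasurableSpace β] {g : Susp T → β}
    (h : Measurable fun p : unitInterval × X => g (Quot.mk _ p)) : Measurable g :=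
  fun _ hs => h hs

lemma measurable_suspPoint : Measurable fun p : ℝ × X => suspPoint T p.1 p.2 := by
  refine (measurable_suspMk T).comp (Measurable.prodMk ?_ ?_)
  · exact (measurable_fract.comp measurable_fst).subtype_mk
  · have h : Measurable fun q : ℤ × X => intIter T q.1 q.2 :=
      measurable_from_prod_countable_right fun k => measurable_intIter T k
    exact h.comp ((Int.measurable_floor.comp measurable_fst).prodMk measurable_snd)

lemma measurable_of_comp_suspPoint {β : Type*} [MeasurableSpace β] {g : Susp T → β}
    (h : Measurable fun p : ℝ × X => g (suspPoint T p.1 p.2)) : Measurable g := by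
  refine measurable_of_comp_suspMk T ?_
  simp only [mk_eq_suspPoint]
  exact h.comp ((measurable_subtype_coe.comp measurable_fst).prodMk measurable_snd)

lemma measurable_suspShift (γ : ℝ) : Measurable (suspShift T γ) := by
  refine measurable_of_comp_suspPoint T ?_
  simp only [suspShift_suspPoint]
  exact (measurable_suspPoint T).comp ((measurable_fst.add_const γ).prodMk measurable_snd)

lemma measurable_suspExt {f : X → ℂ} (hf : Measurable f) : Measurable (suspExt T f) := by
  refine measurable_of_comp_suspPoint T ?_
  simp only [suspExt_suspPoint]
  have h : Measurable fun q : ℤ × X => intIter T q.1 q.2 :=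
    measurable_from_prod_countable_right fun k => measurable_intIter T k
  exact hf.comp (h.comp ((Int.measurable_floor.comp measurable_fst).prodMk measurable_snd))

variable {T} {μ : Measure X}

lemma measurePreserving_intIter (hT : MeasurePreserving T μ μ) (k : ℤ) :
    MeasurePreserving (intIter T k) μ μ := by
  obtain ⟨n, rfl | rfl⟩ := k.eq_nat_or_neg
  · rw [show intIter T n = T^[n] from funext (intIter_natCast T n)]
    exact hT.iterate n
  · rw [show intIter T (-n) = T.symm^[n] from funext (intIter_neg_natCast T n)]
    exact (hT.symm T).iterate n

lemma suspExt_suspPoint_ae (f : X → ℂ) :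
    (fun p : ℝ × X => suspExt T f (suspPoint T p.1 p.2))
      =ᵐ[(volume.restrict (Set.Ioc (0 : ℝ) 1)).prod μ] fun p => f p.2 := by
  have h : ∀ᵐ t ∂(volume.restrict (Set.Ioc (0 : ℝ) 1)), t ∈ Set.Ioo (0 : ℝ) 1 := by
    -- The endpoint `t = 1` must be discarded, since its integer part is `1`.
    rw [← restrict_Ioo_eq_restrict_Ioc]
    exact ae_restrict_mem measurableSet_Ioo
  filter_upwards [Measure.quasiMeasurePreserving_fst.ae h] with p hp
  rw [suspExt_suspPoint, Int.floor_eq_zero_iff.2 ⟨hp.1.le, hp.2⟩, intIter_zero]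

variable [IsProbabilityMeasure μ]

instance : IsProbabilityMeasure (suspMeasure T μ) :=
  Measure.isProbabilityMeasure_map (measurable_suspMk T).aemeasurable

/-- `suspMeasure` in terms of Lebesgue measure on a half-open interval. -/
lemma map_suspPoint :
    ((volume.restrict (Set.Ioc (0 : ℝ) 1)).prod μ).map (fun p : ℝ × X => suspPoint T p.1 p.2)
      = suspMeasure T μ := by
  have h1 : (volume : Measure unitInterval).map (Subtype.val) = volume.restrict (Set.Ioc (0 : ℝ) 1) := by
    rw [restrict_Ioc_eq_restrict_Icc]
    exact map_comap_subtype_coe measurableSet_Icc _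
  have h2 := Measure.map_prod_map (volume : Measure unitInterval) μ
    (f := Subtype.val) (g := id) measurable_subtype_coe measurable_id
  rw [Measure.map_id, h1] at h2
  rw [h2, Measure.map_map (measurable_suspPoint T) (measurable_subtype_coe.prodMap measurable_id)]
  simp only [suspMeasure]
  congr 1
  funext p
  exact (mk_eq_suspPoint T p).symm

lemma measurePreserving_suspPoint :
    MeasurePreserving (fun p : ℝ × X => suspPoint T p.1 p.2)
      ((volume.restrict (Set.Ioc (0 : ℝ) 1)).prod μ) (suspMeasure T μ) :=
  ⟨measurable_suspPoint T, map_suspPoint⟩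

/-- A function of period one has the same integral over all intervals of length one. -/
lemma setLIntegral_Ioc_add_of_periodic {c : ℝ → ENNReal} (hc : Function.Periodic c 1) (γ : ℝ) :
    ∫⁻ t in Set.Ioc (0 : ℝ) 1, c (t + γ) = ∫⁻ t in Set.Ioc (0 : ℝ) 1, c t := by
  have h1 : ∫⁻ t in Set.Ioc (0 : ℝ) 1, c (t + γ) = ∫⁻ t in Set.Ioc γ (γ + 1), c t := by
    have := (measurePreserving_add_right (volume : Measure ℝ) γ).setLIntegral_comp_preimage_emb
      (MeasurableEquiv.addRight γ).measurableEmbedding c (Set.Ioc γ (γ + 1))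
    rw [← this]
    congr 2
    ext t; simp [add_comm γ]
  rw [h1]
  have := IsAddFundamentalDomain.setLIntegral_eq
    (isAddFundamentalDomain_Ioc (zero_lt_one' ℝ) γ volume)
    (isAddFundamentalDomain_Ioc (zero_lt_one' ℝ) 0 volume) c hc.map_vadd_zmultiples
  simpa using this

/-- The measure of the slice of `A` at height `t` has period one in `t`, because `T` preserves `μ`;
a translation by `γ` does not change its integral over a period. -/
lemma measurePreserving_suspShift (hT : MeasurePreserving T μ μ) (γ : ℝ) :
    MeasurePreserving (suspShift T γ) (suspMeasure T μ) (suspMeasure T μ) := by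
  refine ⟨measurable_suspShift T γ, ?_⟩
  ext A hA
  have key : ∀ B : Set (Susp T), MeasurableSet B → suspMeasure T μ B
      = ∫⁻ t in Set.Ioc (0 : ℝ) 1, μ {x | suspPoint T t x ∈ B} := fun B hB => by
    rw [← map_suspPoint, Measure.map_apply (measurable_suspPoint T) hB,
      Measure.prod_apply (measurable_suspPoint T hB)]
    rfl
  rw [Measure.map_apply (measurable_suspShift T γ) hA, key A hA,
    key _ (measurable_suspShift T γ hA)]
  simp only [Set.mem_preimage, suspShift_suspPoint]
  refine setLIntegral_Ioc_add_of_periodic (c := fun t => μ {x | suspPoint T t x ∈ A})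
    (fun t => ?_) γ
  simp only [suspPoint_add_one]
  have hm : MeasurableSet {x | suspPoint T t x ∈ A} :=
    (measurable_suspPoint T).comp measurable_prodMk_left hA
  exact hT.measure_preimage hm.nullMeasurableSet

lemma memLp_suspExt {f : X → ℂ} (hf : Measurable f)
    (hf2 : MemLp f 2 μ) : MemLp (suspExt T f) 2 (suspMeasure T μ) := by
  rw [← map_suspPoint, memLp_map_measure_iff (measurable_suspExt T hf).aestronglyMeasurable
    (measurable_suspPoint T).aemeasurable]
  have h1 : MemLp (fun p : ℝ × X => f p.2) 2 ((volume.restrict (Set.Ioc (0 : ℝ) 1)).prod μ) :=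
    hf2.comp_snd _
  exact h1.ae_eq (suspExt_suspPoint_ae f).symm

/-- Fubini in the coordinates `(t, x)`. The integer translates come from the measure-preserving
shifts by `k`, and they spread the good heights over the whole line. -/
lemma ae_suspPoint (hT : MeasurePreserving T μ μ) {P : Susp T → Prop}
    (h : ∀ᵐ y ∂(suspMeasure T μ), P y) :
    ∀ᵐ x ∂μ, ∀ᵐ t ∂(volume.restrict (Set.Ioc (0 : ℝ) 1)), ∀ k : ℤ,
      P (suspPoint T (t + k) x) := by
  have h1 : ∀ᵐ y ∂(suspMeasure T μ), ∀ k : ℤ, P (suspShift T k y) :=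
    ae_all_iff.2 fun k => (measurePreserving_suspShift hT k).quasiMeasurePreserving.ae h
  have h2 := measurePreserving_suspPoint.quasiMeasurePreserving.ae h1
  simp only [suspShift_suspPoint] at h2
  exact Measure.ae_ae_of_ae_prod
    ((Measure.measurePreserving_swap (μ := μ)
      (ν := volume.restrict (Set.Ioc (0 : ℝ) 1))).quasiMeasurePreserving.ae h2)

end Suspension

/-! ### Invariance and measurability of the pointwise limit. -/

section Limit

lemma tendsto_birkhoffAverage_apply_iff {α : Type*} {S : α → α} {g : α → ℂ} {x : α} {L : ℂ} :
    Tendsto (fun n : ℕ => birkhoffAverage ℂ S g n (S x)) atTop (𝓝 L) ↔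
      Tendsto (fun n : ℕ => birkhoffAverage ℂ S g n x) atTop (𝓝 L) := by
  have key : ∀ n : ℕ, ((n : ℂ) + 1) * birkhoffAverage ℂ S g (n + 1) x
      = g x + n * birkhoffAverage ℂ S g n (S x) := fun n => by
    have h1 : (n : ℂ) + 1 ≠ 0 := Nat.cast_add_one_ne_zero n
    rcases eq_or_ne n 0 with rfl | hn
    · simp
    · have h2 : (n : ℂ) ≠ 0 := Nat.cast_ne_zero.2 hn
      simp only [birkhoffAverage, smul_eq_mul, birkhoffSum_succ', Nat.cast_succ]
      rw [mul_inv_cancel_left₀ h1, mul_inv_cancel_left₀ h2]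
  have t0 : Tendsto (fun n : ℕ => (1 : ℂ) / ((n : ℂ) + 1)) atTop (𝓝 0) :=
    tendsto_one_div_add_atTop_nhds_zero_nat
  have t1 : Tendsto (fun n : ℕ => ((n : ℂ) + 1)⁻¹) atTop (𝓝 0) := by simpa using t0
  have t2 : Tendsto (fun n : ℕ => (n : ℂ)⁻¹) atTop (𝓝 0) := tendsto_inv_atTop_nhds_zero_nat
  rw [← tendsto_add_atTop_iff_nat (f := fun n => birkhoffAverage ℂ S g n x) 1]
  constructor
  · intro h
    have h3 := (t1.const_mul (g x)).add ((t1.const_sub 1).mul h)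
    simp only [mul_zero, zero_add, sub_zero, one_mul] at h3
    refine h3.congr fun n => ?_
    have h1 : (n : ℂ) + 1 ≠ 0 := Nat.cast_add_one_ne_zero n
    have h4 := key n
    apply mul_left_cancel₀ h1
    rw [h4]
    field_simp
    ring
  · intro h
    have h3 := ((t2.const_add 1).mul h).sub (t2.const_mul (g x))
    simp only [mul_zero, sub_zero, add_zero, one_mul] at h3
    refine h3.congr' ?_
    filter_upwards [eventually_ne_atTop 0] with n hn
    have h2 : (n : ℂ) ≠ 0 := Nat.cast_ne_zero.2 hn
    have h4 := key n
    apply mul_left_cancel₀ h2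
    have : (n : ℂ) * ((1 + (n : ℂ)⁻¹) * birkhoffAverage ℂ S g (n + 1) x - g x * (n : ℂ)⁻¹)
        = ((n : ℂ) + 1) * birkhoffAverage ℂ S g (n + 1) x - g x := by
      field_simp
    rw [this, h4]
    ring

variable {X : Type*} [MeasurableSpace X] {T : X ≃ᵐ X} {γ : ℝ} {f : X → ℂ}

/-- Convergence to any given `L` is the same condition at `y` and at its image, so the two values
agree even where the averages diverge and both are the junk value. Invariance thus holds everywhere,
not merely almost everywhere. -/
lemma suspLimit_suspShift (y : Susp T) :
    suspLimit T γ f (suspShift T γ y) = suspLimit T γ f y := by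
  simp only [suspLimit, limUnder, lim]
  congr 1
  funext L
  exact propext tendsto_birkhoffAverage_apply_iff

lemma suspLimit_eq {y : Susp T} {L : ℂ}
    (h : Tendsto (fun N : ℕ => birkhoffAverage ℂ (suspShift T γ) (suspExt T f) N y) atTop (𝓝 L)) :
    suspLimit T γ f y = L := h.limUnder_eq

lemma measurable_birkhoffAverage {α : Type*} [MeasurableSpace α] {S : α → α} (hS : Measurable S)
    {g : α → ℂ} (hg : Measurable g) (n : ℕ) : Measurable (birkhoffAverage ℂ S g n) := by
  unfold birkhoffAverage birkhoffSum
  have h : Measurable fun x => ∑ k ∈ Finset.range n, g (S^[k] x) :=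
    Finset.measurable_fun_sum _ fun k _ => hg.comp (hS.iterate k)
  exact h.const_smul (n : ℂ)⁻¹

lemma measurable_suspLimit (hf : Measurable f) :
    Measurable[MeasurableSpace.invariants (suspShift T γ)] (suspLimit T γ f) := by
  rw [MeasurableSpace.measurable_invariants_dom]
  refine ⟨?_, fun s _ => ?_⟩
  · have := (StronglyMeasurable.limUnder (l := atTop) fun N : ℕ =>
      (measurable_birkhoffAverage (measurable_suspShift T γ)
        (measurable_suspExt T hf) N).stronglyMeasurable).measurable
    exact this
  · rw [show suspLimit T γ f ∘ suspShift T γ = suspLimit T γ f from funext suspLimit_suspShift]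

end Limit

/-! ### Averages along `⌊γ n + t⌋` and their dependence on `t`. -/

section Rotation

/-- The averages of the two-sided sequence `a` along the integer parts of `γ n + t`. -/
noncomputable def floorAvg (a : ℤ → ℂ) (γ : ℝ) (N : ℕ) (t : ℝ) : ℂ :=
  (1 / (N : ℂ)) * ∑ n ∈ Finset.range N, a ⌊γ * n + t⌋

/-- The blocks `{n, …, n + K}` with `n ∈ B` are disjoint and lie in `range (N + K)`. -/
lemma card_mul_le_of_gaps {B : Finset ℕ} {N K : ℕ} (hB : B ⊆ Finset.range N)
    (h : ∀ m ∈ B, ∀ n ∈ B, m < n → K < n - m) : B.card * (K + 1) ≤ N + K := by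
  have h1 : (B ×ˢ Finset.range (K + 1)).card ≤ (Finset.range (N + K)).card := by
    refine Finset.card_le_card_of_injOn (fun p => p.1 + p.2) ?_ ?_
    · rintro ⟨n, j⟩ hp
      simp only [Finset.coe_product, Set.mem_prod, Finset.mem_coe, Finset.mem_range] at hp
      have := Finset.mem_range.1 (hB hp.1)
      simp only [Finset.coe_range, Set.mem_Iio]
      omega
    · rintro ⟨n, j⟩ hp ⟨n', j'⟩ hp' hpp
      simp only [Finset.coe_product, Set.mem_prod, Finset.mem_coe, Finset.mem_range] at hp hp' hpp
      have hn : n = n' := by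
        rcases lt_trichotomy n n' with hl | hl | hl
        · have := h n hp.1 n' hp'.1 hl
          omega
        · exact hl
        · have := h n' hp'.1 n hp.1 hl
          omega
      subst hn
      simp only [Prod.mk.injEq, true_and]
      omega
  simpa using h1

lemma exists_lt_abs_mul_sub_intCast {γ : ℝ} (hγ : Irrational γ) (K : ℕ) :
    ∃ δ : ℝ, 0 < δ ∧ ∀ j : ℕ, 0 < j → j ≤ K → ∀ z : ℤ, δ < |γ * j - z| := by
  induction K with
  | zero => exact ⟨1, one_pos, fun j h1 h2 => by omega⟩
  | succ K ih =>
    obtain ⟨δ, hδ, h⟩ := ih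
    have hirr : Irrational (γ * (K + 1 : ℕ)) := hγ.mul_natCast K.succ_ne_zero
    set d := |γ * (K + 1 : ℕ) - round (γ * (K + 1 : ℕ))|
    have hd : 0 < d := abs_pos.2 (sub_ne_zero.2 (hirr.ne_int _))
    refine ⟨min δ (d / 2), lt_min hδ (half_pos hd), fun j h1 h2 z => ?_⟩
    rcases Nat.le_succ_iff.1 h2 with h3 | rfl
    · exact (min_le_left _ _).trans_lt (h j h1 h3 z)
    · exact (min_le_right _ _).trans_lt ((half_lt_self hd).trans_le (round_le _ z))

/-- Visits of an irrational rotation to a short arc are far apart. -/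
lemma exists_visits_gap {γ : ℝ} (hγ : Irrational γ) (K : ℕ) :
    ∃ δ : ℝ, 0 < δ ∧ ∀ (ℓ : ℝ) (m n : ℕ), m < n → 1 - δ ≤ Int.fract (γ * m + ℓ) →
      1 - δ ≤ Int.fract (γ * n + ℓ) → K < n - m := by
  obtain ⟨δ, hδ, h⟩ := exists_lt_abs_mul_sub_intCast hγ K
  refine ⟨δ, hδ, fun ℓ m n hmn h1 h2 => ?_⟩
  -- Both fractional parts lie in `[1 - δ, 1)`, so `γ (n - m)` is within `δ` of an integer, which
  -- the choice of `δ` forbids for `n - m ≤ K`.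
  by_contra! hK
  have h3 := h (n - m) (by omega) hK (⌊γ * n + ℓ⌋ - ⌊γ * m + ℓ⌋)
  have e1 := Int.floor_add_fract (γ * n + ℓ)
  have e2 := Int.floor_add_fract (γ * m + ℓ)
  have l1 := Int.fract_lt_one (γ * n + ℓ)
  have l2 := Int.fract_lt_one (γ * m + ℓ)
  have e3 : γ * ((n - m : ℕ) : ℝ) - ((⌊γ * n + ℓ⌋ - ⌊γ * m + ℓ⌋ : ℤ) : ℝ)
      = Int.fract (γ * n + ℓ) - Int.fract (γ * m + ℓ) := by
    rw [Nat.cast_sub hmn.le]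
    push_cast
    linarith
  rw [e3] at h3
  refine absurd h3 (not_lt.2 (abs_le.2 ⟨?_, ?_⟩)) <;> linarith

/-- Two indices with the same integer part satisfy `|γ| |n - n'| < 1`, so the fibre lies in an
interval of length `1/|γ|`. -/
lemma card_floor_fibre_le {γ : ℝ} (hγ : γ ≠ 0) (t : ℝ) (N : ℕ) (k : ℤ) :
    ((Finset.range N).filter fun n : ℕ => ⌊γ * n + t⌋ = k).card ≤ ⌊|γ|⁻¹⌋₊ + 1 := by
  set B := (Finset.range N).filter fun n : ℕ => ⌊γ * n + t⌋ = k
  rcases B.eq_empty_or_nonempty with hB | hB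
  · simp [hB]
  have hγ' : 0 < |γ| := abs_pos.2 hγ
  have hsub : B ⊆ Finset.Icc (B.min' hB) (B.min' hB + ⌊|γ|⁻¹⌋₊) := by
    intro n hn
    have hmin := B.min'_le n hn
    refine Finset.mem_Icc.2 ⟨hmin, ?_⟩
    have h1 : ⌊γ * n + t⌋ = k := (Finset.mem_filter.1 hn).2
    have h2 : ⌊γ * (B.min' hB : ℕ) + t⌋ = k := (Finset.mem_filter.1 (B.min'_mem hB)).2
    have h3 : |γ| * ((n - B.min' hB : ℕ) : ℝ) ≤ 1 := by
      have h4 : |γ * n - γ * (B.min' hB : ℕ)| < 1 := by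
        have := Int.abs_sub_lt_one_of_floor_eq_floor (h1.trans h2.symm)
        simpa using this
      rw [← mul_sub, abs_mul] at h4
      rw [Nat.cast_sub hmin]
      exact (mul_le_mul_of_nonneg_left (le_abs_self _) hγ'.le).trans h4.le
    have h5 : n - B.min' hB ≤ ⌊|γ|⁻¹⌋₊ := by
      refine Nat.le_floor ?_
      rw [← one_div, le_div_iff₀ hγ', mul_comm]
      exact h3
    omega
  refine (Finset.card_le_card hsub).trans ?_
  simp [Nat.card_Icc]
  omega

/-- Every integer is hit a bounded number of times, and only integers of size `O(N)` are hit,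
uniformly for `|t| ≤ R`. -/
lemma sum_floor_le {γ : ℝ} (hγ : γ ≠ 0) {b : ℤ → ℝ} (hb : ∀ k, 0 ≤ b k) {C : ℝ}
    (hC : ∀ M : ℕ, ∑ k ∈ Finset.Icc (-(M : ℤ)) M, b k ≤ C * (M + 1)) (R : ℝ) :
    ∃ C' : ℝ, 0 ≤ C' ∧ ∀ t : ℝ, |t| ≤ R → ∀ N : ℕ, 1 ≤ N →
      ∑ n ∈ Finset.range N, b ⌊γ * n + t⌋ ≤ C' * N := by
  have hC0 : 0 ≤ C := by
    have := hC 0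
    have h2 : 0 ≤ ∑ k ∈ Finset.Icc (-((0 : ℕ) : ℤ)) (0 : ℕ), b k :=
      Finset.sum_nonneg fun k _ => hb k
    simpa using h2.trans this
  set K₀ : ℕ := ⌊|γ|⁻¹⌋₊ + 1
  refine ⟨K₀ * (C * (|γ| + |R| + 3)), by positivity, fun t ht N hN => ?_⟩
  have hN' : (1 : ℝ) ≤ N := by exact_mod_cast hN
  have htR : |t| ≤ |R| := ht.trans (le_abs_self R)
  -- The `+ 1` absorbs the loss in taking the floor. Then `M + 1 ≤ |γ| N + |t| + 3`, which is at
  -- most `(|γ| + |R| + 3) N` because `N ≥ 1`.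
  set M : ℕ := ⌈|γ| * N + |t| + 1⌉₊
  have hM1 : |γ| * N + |t| + 1 ≤ M := Nat.le_ceil _
  have hM2 : (M : ℝ) < |γ| * N + |t| + 1 + 1 := Nat.ceil_lt_add_one (by positivity)
  have hmaps : ∀ n ∈ Finset.range N, ⌊γ * n + t⌋ ∈ Finset.Icc (-(M : ℤ)) M := by
    intro n hn
    have hn' : (n : ℝ) ≤ N := by exact_mod_cast (Finset.mem_range.1 hn).le
    have h1 : |γ * n + t| ≤ |γ| * N + |t| := by
      refine (abs_add_le _ _).trans (add_le_add ?_ le_rfl)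
      rw [abs_mul, Nat.abs_cast]
      exact mul_le_mul_of_nonneg_left hn' (abs_nonneg _)
    have h2 := abs_le.1 h1
    have h3 := Int.floor_le (γ * n + t)
    have h4 := Int.lt_floor_add_one (γ * n + t)
    rw [Finset.mem_Icc]
    constructor
    · have : (-(M : ℝ)) ≤ (⌊γ * n + t⌋ : ℝ) := by linarith
      exact_mod_cast this
    · have : (⌊γ * n + t⌋ : ℝ) ≤ M := by linarith
      exact_mod_cast this
  calc ∑ n ∈ Finset.range N, b ⌊γ * n + t⌋
      = ∑ k ∈ Finset.Icc (-(M : ℤ)) M,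
          ∑ n ∈ (Finset.range N).filter (fun n : ℕ => ⌊γ * n + t⌋ = k), b ⌊γ * n + t⌋ :=
        (Finset.sum_fiberwise_of_maps_to hmaps _).symm
    _ ≤ ∑ k ∈ Finset.Icc (-(M : ℤ)) M, K₀ * b k := by
        refine Finset.sum_le_sum fun k _ => ?_
        rw [Finset.sum_congr rfl (g := fun _ => b k)
          fun n hn => by rw [(Finset.mem_filter.1 hn).2], Finset.sum_const, nsmul_eq_mul]
        exact mul_le_mul_of_nonneg_right
          (by exact_mod_cast card_floor_fibre_le hγ t N k) (hb k)
    _ = K₀ * ∑ k ∈ Finset.Icc (-(M : ℤ)) M, b k := by rw [Finset.mul_sum]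
    _ ≤ K₀ * (C * (M + 1)) := mul_le_mul_of_nonneg_left (hC M) (Nat.cast_nonneg _)
    _ ≤ K₀ * (C * ((|γ| + |R| + 3) * N)) := by
        refine mul_le_mul_of_nonneg_left (mul_le_mul_of_nonneg_left ?_ hC0) (Nat.cast_nonneg _)
        have : |R| ≤ |R| * N := le_mul_of_one_le_right (abs_nonneg _) hN'
        linarith
    _ = K₀ * (C * (|γ| + |R| + 3)) * N := by ring

variable {a : ℤ → ℂ} {C γ : ℝ}

/-- The averages of a sequence with bounded square means depend continuously on the starting
point, asymptotically. -/
lemma eventually_norm_floorAvg_sub_le (hγ : Irrational γ)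
    (hC : ∀ M : ℕ, ∑ k ∈ Finset.Icc (-(M : ℤ)) M, ‖a k‖ ^ 2 ≤ C * (M + 1)) (R : ℝ)
    {ε : ℝ} (hε : 0 < ε) :
    ∃ δ : ℝ, 0 < δ ∧ ∀ ℓ s : ℝ, |ℓ| ≤ R → |s| ≤ R → ℓ ≤ s → s < ℓ + δ →
      ∀ᶠ N : ℕ in atTop, ‖floorAvg a γ N s - floorAvg a γ N ℓ‖ ≤ ε := by
  obtain ⟨C', hC'0, hC'⟩ := sum_floor_le hγ.ne_zero (fun k => sq_nonneg ‖a k‖) hC R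
  -- Below, `B` has at most `2 N / (K + 1)` elements. Cauchy–Schwarz bounds a sum over `B` by `N`
  -- times the square root of `2 C' / (K + 1)`, and this choice of `K` makes that at most `ε / 2 *
  -- N`.
  obtain ⟨K, hK⟩ := exists_nat_gt (2 * C' / (ε / 2) ^ 2)
  obtain ⟨δ, hδ, hgap⟩ := exists_visits_gap hγ K
  refine ⟨δ, hδ, fun ℓ s hℓ hs hℓs hsδ => ?_⟩
  filter_upwards [eventually_ge_atTop (K + 1)] with N hN
  have hN1 : 1 ≤ N := by omega
  have hNpos : (0 : ℝ) < N := by exact_mod_cast hN1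
  -- Outside `B`, adding `s - ℓ < δ` does not carry `γ n + ℓ` past the next integer, so only indices
  -- in `B` contribute to the difference.
  set B := (Finset.range N).filter fun n : ℕ => 1 - δ ≤ Int.fract (γ * n + ℓ)
  have hBN : B ⊆ Finset.range N := Finset.filter_subset _ _
  have hBcard : (B.card : ℝ) * (K + 1) ≤ 2 * N := by
    have h1 := card_mul_le_of_gaps (K := K) hBN fun m hm n hn hmn =>
      hgap ℓ m n hmn (Finset.mem_filter.1 hm).2 (Finset.mem_filter.1 hn).2
    have h2 : B.card * (K + 1) ≤ 2 * N := by omega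
    exact_mod_cast h2
  have hsum : ∀ t : ℝ, |t| ≤ R → ∑ n ∈ B, ‖a ⌊γ * n + t⌋‖ ≤ ε / 2 * N := by
    intro t ht
    refine (abs_le_of_sq_le_sq' ?_ (by positivity)).2
    have h1 : (∑ n ∈ B, ‖a ⌊γ * n + t⌋‖) ^ 2 ≤ B.card * ∑ n ∈ B, ‖a ⌊γ * n + t⌋‖ ^ 2 :=
      sq_sum_le_card_mul_sum_sq
    have h2 : ∑ n ∈ B, ‖a ⌊γ * n + t⌋‖ ^ 2 ≤ C' * N :=
      (Finset.sum_le_sum_of_subset_of_nonneg hBN fun n _ _ => sq_nonneg _).trans (hC' t ht N hN1)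
    have h3 : (B.card : ℝ) * (C' * N) ≤ (ε / 2) ^ 2 * N * N := by
      have hK' : 2 * C' ≤ (K + 1) * (ε / 2) ^ 2 := by
        rw [div_lt_iff₀ (by positivity)] at hK
        nlinarith [sq_nonneg (ε / 2)]
      have h4 : (B.card : ℝ) * (2 * C') ≤ 2 * N * (ε / 2) ^ 2 := by
        calc (B.card : ℝ) * (2 * C') ≤ B.card * ((K + 1) * (ε / 2) ^ 2) :=
              mul_le_mul_of_nonneg_left hK' (Nat.cast_nonneg _)
          _ = B.card * (K + 1) * (ε / 2) ^ 2 := by ring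
          _ ≤ 2 * N * (ε / 2) ^ 2 := mul_le_mul_of_nonneg_right hBcard (sq_nonneg _)
      have h5 : (B.card : ℝ) * C' ≤ (ε / 2) ^ 2 * N := by linarith
      calc (B.card : ℝ) * (C' * N) = B.card * C' * N := by ring
        _ ≤ _ := mul_le_mul_of_nonneg_right h5 hNpos.le
    calc _ ≤ B.card * ∑ n ∈ B, ‖a ⌊γ * n + t⌋‖ ^ 2 := h1
      _ ≤ B.card * (C' * N) := mul_le_mul_of_nonneg_left h2 (Nat.cast_nonneg _)
      _ ≤ _ := h3
      _ = _ := by ring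
  have hdiff : floorAvg a γ N s - floorAvg a γ N ℓ
      = (1 / (N : ℂ)) * ∑ n ∈ B, (a ⌊γ * n + s⌋ - a ⌊γ * n + ℓ⌋) := by
    rw [floorAvg, floorAvg, ← mul_sub, ← Finset.sum_sub_distrib]
    congr 1
    refine (Finset.sum_subset hBN fun n hn hnB => ?_).symm
    have h1 : Int.fract (γ * n + ℓ) < 1 - δ := by
      by_contra! h
      exact hnB (Finset.mem_filter.2 ⟨hn, h⟩)
    have h2 : ⌊γ * n + s⌋ = ⌊γ * n + ℓ⌋ := by
      have h3 := Int.floor_add_fract (γ * n + ℓ)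
      have h4 := Int.fract_nonneg (γ * n + ℓ)
      rw [Int.floor_eq_iff]
      constructor <;> linarith
    rw [h2, sub_self]
  rw [hdiff, norm_mul, norm_div, norm_one, Complex.norm_natCast, one_div, inv_mul_le_iff₀ hNpos]
  calc ‖∑ n ∈ B, (a ⌊γ * n + s⌋ - a ⌊γ * n + ℓ⌋)‖
      ≤ ∑ n ∈ B, (‖a ⌊γ * n + s⌋‖ + ‖a ⌊γ * n + ℓ⌋‖) :=
        norm_sum_le_of_le _ fun n _ => norm_sub_le _ _
    _ ≤ ε / 2 * N + ε / 2 * N := by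
        rw [Finset.sum_add_distrib]
        exact add_le_add (hsum s hs) (hsum ℓ hℓ)
    _ = N * ε := by ring

/-- The averages at `ℓ` stay close to those at some nearby `s` on its right where they converge, so
they form a Cauchy sequence. -/
lemma exists_tendsto_floorAvg (hγ : Irrational γ)
    (hC : ∀ M : ℕ, ∑ k ∈ Finset.Icc (-(M : ℤ)) M, ‖a k‖ ^ 2 ≤ C * (M + 1))
    (hD : ∀ ℓ δ : ℝ, 0 < δ → ∃ s, ℓ ≤ s ∧ s < ℓ + δ ∧
      ∃ L, Tendsto (fun N => floorAvg a γ N s) atTop (𝓝 L)) (ℓ : ℝ) :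
    ∃ L, Tendsto (fun N => floorAvg a γ N ℓ) atTop (𝓝 L) := by
  refine cauchySeq_tendsto_of_complete (Metric.cauchySeq_iff'.2 fun ε hε => ?_)
  obtain ⟨δ, hδ, h⟩ := eventually_norm_floorAvg_sub_le hγ hC (|ℓ| + 1) (ε := ε / 6) (by positivity)
  obtain ⟨s, h1, h2, L, hL⟩ := hD ℓ (min δ 1) (lt_min hδ one_pos)
  have h2' : s < ℓ + δ := h2.trans_le (by simp)
  have h2'' : s < ℓ + 1 := h2.trans_le (by simp)
  have hs : |s| ≤ |ℓ| + 1 := by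
    rw [abs_le]
    constructor <;> linarith [neg_abs_le ℓ, le_abs_self ℓ]
  have h3 := h ℓ s (by linarith [abs_nonneg ℓ]) hs h1 h2'
  have h4 : ∀ᶠ N in atTop, dist (floorAvg a γ N s) L < ε / 6 :=
    Metric.tendsto_nhds.1 hL _ (by positivity)
  obtain ⟨N, hN⟩ := eventually_atTop.1 (h3.and h4)
  have key : ∀ n ≥ N, dist (floorAvg a γ n ℓ) L < ε / 3 := fun n hn => by
    have := hN n hn
    rw [← dist_eq_norm, dist_comm] at this
    have := dist_triangle (floorAvg a γ n ℓ) (floorAvg a γ n s) L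
    linarith [(hN n hn).2]
  refine ⟨N, fun n hn => ?_⟩
  have := dist_triangle_right (floorAvg a γ n ℓ) (floorAvg a γ N ℓ) L
  linarith [key n hn, key N le_rfl]

lemma continuous_of_tendsto_floorAvg (hγ : Irrational γ)
    (hC : ∀ M : ℕ, ∑ k ∈ Finset.Icc (-(M : ℤ)) M, ‖a k‖ ^ 2 ≤ C * (M + 1)) {H : ℝ → ℂ}
    (hH : ∀ t, Tendsto (fun N => floorAvg a γ N t) atTop (𝓝 (H t))) : Continuous H := by
  refine Metric.continuous_iff.2 fun t ε hε => ?_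
  obtain ⟨δ, hδ, h⟩ := eventually_norm_floorAvg_sub_le hγ hC (|t| + 1) (ε := ε / 2) (by positivity)
  have key : ∀ ℓ s : ℝ, |ℓ| ≤ |t| + 1 → |s| ≤ |t| + 1 → ℓ ≤ s → s < ℓ + δ →
      dist (H s) (H ℓ) ≤ ε / 2 := fun ℓ s h1 h2 h3 h4 => by
    rw [dist_eq_norm]
    exact le_of_tendsto ((hH s).sub (hH ℓ)).norm (h ℓ s h1 h2 h3 h4)
  refine ⟨min δ 1, lt_min hδ one_pos, fun s hs => ?_⟩
  have h1 : |s - t| < δ := lt_of_lt_of_le hs (min_le_left _ _)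
  have h2 : |s - t| < 1 := lt_of_lt_of_le hs (min_le_right _ _)
  have hs' : |s| ≤ |t| + 1 := by
    have := abs_add_le t (s - t)
    rw [add_sub_cancel] at this
    linarith
  have ht' : |t| ≤ |t| + 1 := by linarith
  have h3 := abs_lt.1 h1
  refine lt_of_le_of_lt ?_ (half_lt_self hε)
  rcases le_total t s with hts | hts
  · exact key t s ht' hs' hts (by linarith)
  · rw [dist_comm]
    exact key s t hs' ht' hts (by linarith)

end Rotation

/-! ### Existence, continuity and square-integrability of the limit for almost every `x`. -/

section Pointwise

variable {X : Type*} [MeasurableSpace X] {μ : Measure X} {T : X ≃ᵐ X} {f : X → ℂ} {γ : ℝ}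

lemma eLpNorm_floorAvg_le (hT : MeasurePreserving T μ μ) (hfm : Measurable f) (N : ℕ) (t : ℝ) :
    eLpNorm (fun x => floorAvg (fun k => f (intIter T k x)) γ N t) 2 μ ≤ eLpNorm f 2 μ := by
  have h1 : eLpNorm (fun x => ∑ n ∈ Finset.range N, f (intIter T ⌊γ * n + t⌋ x)) 2 μ
      ≤ N * eLpNorm f 2 μ := by
    have h2 := eLpNorm_sum_le (μ := μ) (p := 2) (s := Finset.range N)
      (f := fun n x => f (intIter T ⌊γ * (n : ℕ) + t⌋ x))
      (fun n _ => (hfm.comp (measurable_intIter T _)).aestronglyMeasurable) one_le_two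
    have h3 : ∀ n : ℕ, eLpNorm (fun x => f (intIter T ⌊γ * n + t⌋ x)) 2 μ = eLpNorm f 2 μ :=
      fun n => eLpNorm_comp_measurePreserving hfm.aestronglyMeasurable
        (measurePreserving_intIter hT _)
    simp only [h3, Finset.sum_const, Finset.card_range, nsmul_eq_mul] at h2
    convert h2 using 2
    ext x; simp
  have h4 : (fun x => floorAvg (fun k => f (intIter T k x)) γ N t)
      = (1 / (N : ℂ)) • fun x => ∑ n ∈ Finset.range N, f (intIter T ⌊γ * n + t⌋ x) := rfl
  rw [h4, eLpNorm_const_smul]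
  rcases Nat.eq_zero_or_pos N with rfl | hN
  · simp
  refine (mul_le_mul_right h1 _).trans ?_
  rw [← mul_assoc]
  have h5 : ‖(1 / (N : ℂ))‖ₑ * (N : ENNReal) = 1 := by
    have h6 : (N : ENNReal) = ‖(N : ℂ)‖ₑ := by
      rw [← ofReal_norm, Complex.norm_natCast, ENNReal.ofReal_natCast]
    rw [h6, ← enorm_mul, one_div, inv_mul_cancel₀ (Nat.cast_ne_zero.2 hN.ne')]
    simp
  rw [h5, one_mul]

variable [IsProbabilityMeasure μ]

lemma exists_birkhoffSum_le (hT : MeasurePreserving T μ μ) {g : X → ℝ} (hgm : Measurable g)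
    (hg : Integrable g μ) : ∀ᵐ x ∂μ, ∃ C : ℝ, ∀ n : ℕ, birkhoffSum T g n x ≤ C * n := by
  filter_upwards [ae_tendsto_birkhoffAverage_real hT hgm hg] with x hx
  obtain ⟨C, hC⟩ := hx.bddAbove_range
  refine ⟨C, fun n => ?_⟩
  have h := hC (Set.mem_range_self n)
  rcases Nat.eq_zero_or_pos n with rfl | hn
  · simp
  · have hn' : (0 : ℝ) < n := by exact_mod_cast hn
    simp only [birkhoffAverage, smul_eq_mul] at h
    rw [inv_mul_le_iff₀ hn'] at h
    linarith

/-- Birkhoff's theorem for `T` and for its inverse bounds the two halves of the orbit; counting `k =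
0` twice is harmless since `g ≥ 0`. -/
lemma exists_sum_intIter_le (hT : MeasurePreserving T μ μ) {g : X → ℝ} (hgm : Measurable g)
    (hg : Integrable g μ) (hg0 : ∀ x, 0 ≤ g x) :
    ∀ᵐ x ∂μ, ∃ C : ℝ, ∀ M : ℕ,
      ∑ k ∈ Finset.Icc (-(M : ℤ)) M, g (intIter T k x) ≤ C * (M + 1) := by
  filter_upwards [exists_birkhoffSum_le hT hgm hg, exists_birkhoffSum_le (hT.symm T) hgm hg]
    with x ⟨C₁, h1⟩ ⟨C₂, h2⟩
  refine ⟨C₁ + C₂, fun M => ?_⟩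
  set s := (Finset.range (M + 1)).image fun n : ℕ => (n : ℤ)
  set t := (Finset.range (M + 1)).image fun n : ℕ => -(n : ℤ)
  have hsub : Finset.Icc (-(M : ℤ)) M ⊆ s ∪ t := by
    intro k hk
    rw [Finset.mem_Icc] at hk
    simp only [s, t, Finset.mem_union, Finset.mem_image, Finset.mem_range]
    obtain ⟨n, rfl | rfl⟩ := k.eq_nat_or_neg
    · exact Or.inl ⟨n, by omega, rfl⟩
    · exact Or.inr ⟨n, by omega, rfl⟩
  have hs : ∑ k ∈ s, g (intIter T k x) = birkhoffSum T g (M + 1) x := by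
    rw [Finset.sum_image fun a _ b _ h => by simpa using h]
    simp only [intIter_natCast, birkhoffSum]
  have ht : ∑ k ∈ t, g (intIter T k x) = birkhoffSum T.symm g (M + 1) x := by
    rw [Finset.sum_image fun a _ b _ h => by simpa using h]
    simp only [intIter_neg_natCast, birkhoffSum]
  have hu := Finset.sum_union_inter (s₁ := s) (s₂ := t) (f := fun k => g (intIter T k x))
  have hi : 0 ≤ ∑ k ∈ s ∩ t, g (intIter T k x) := Finset.sum_nonneg fun k _ => hg0 _
  have h3 : ∑ k ∈ Finset.Icc (-(M : ℤ)) M, g (intIter T k x) ≤ ∑ k ∈ s ∪ t, g (intIter T k x) :=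
    Finset.sum_le_sum_of_subset_of_nonneg hsub fun k _ _ => hg0 _
  have h4 := h1 (M + 1)
  have h5 := h2 (M + 1)
  push_cast at h4 h5
  linarith

lemma exists_mem_Ico_of_ae {P : ℝ → Prop}
    (h : ∀ᵐ t ∂(volume.restrict (Set.Ioc (0 : ℝ) 1)), ∀ k : ℤ, P (t + k)) (ℓ δ : ℝ) (hδ : 0 < δ) :
    ∃ s, ℓ ≤ s ∧ s < ℓ + δ ∧ P s := by
  rw [ae_restrict_iff' measurableSet_Ioc] at h
  have hd := Measure.dense_of_ae h
  have h1 : Int.fract ℓ < min (Int.fract ℓ + δ) 1 :=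
    lt_min (lt_add_of_pos_right _ hδ) (Int.fract_lt_one ℓ)
  obtain ⟨t, ht, h2, h3⟩ := hd.exists_between h1
  have h4 := Int.floor_add_fract ℓ
  refine ⟨t + ⌊ℓ⌋, by linarith, ?_, ht ⟨(Int.fract_nonneg ℓ).trans_lt h2,
    (h3.trans_le (min_le_right _ _)).le⟩ _⟩
  have := h3.trans_le (min_le_left _ _)
  linarith

lemma ae_tendsto_suspLimit (hT : MeasurePreserving T μ μ) (hfm : Measurable f)
    (hf : MemLp f 2 μ) :
    ∀ᵐ y ∂(suspMeasure T μ),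
      Tendsto (fun N : ℕ => birkhoffAverage ℂ (suspShift T γ) (suspExt T f) N y) atTop
        (𝓝 (suspLimit T γ f y)) ∧ suspLimit T γ f y
        = ((suspMeasure T μ)[suspExt T f | MeasurableSpace.invariants (suspShift T γ)]) y := by
  have hint : Integrable (suspExt T f) (suspMeasure T μ) :=
    (memLp_suspExt hfm hf).integrable one_le_two
  filter_upwards [ae_tendsto_birkhoffAverage (measurePreserving_suspShift hT γ)
    (measurable_suspExt T hfm) hint] with y hy
  rw [suspLimit_eq hy]
  exact ⟨hy, rfl⟩

/-- One null set serves all `t`: it only has to ensure bounded square means of `f` along the orbit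
and convergence at a dense set of heights. The passage to the other heights is deterministic. -/
lemma ae_tendsto_floorAvg (hT : MeasurePreserving T μ μ) (hγ : Irrational γ) (hfm : Measurable f)
    (hf : MemLp f 2 μ) :
    ∀ᵐ x ∂μ, (∀ t, Tendsto (fun N => floorAvg (fun k => f (intIter T k x)) γ N t) atTop
        (𝓝 (suspLimit T γ f (suspPoint T t x)))) ∧
      Continuous fun t => suspLimit T γ f (suspPoint T t x) := by
  have hsq : Integrable (fun x => ‖f x‖ ^ 2) μ := (memLp_two_iff_integrable_sq_norm hf.1).1 hf
  filter_upwards [exists_sum_intIter_le hT (hfm.norm.pow_const 2) hsq fun x => sq_nonneg _,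
    ae_suspPoint hT (ae_tendsto_suspLimit (γ := γ) hT hfm hf)] with x ⟨C, hC⟩ hx
  have hlim : ∀ t, Tendsto (fun N => floorAvg (fun k => f (intIter T k x)) γ N t) atTop
        (𝓝 (suspLimit T γ f (suspPoint T t x))) := fun t => by
    obtain ⟨L, hL⟩ := exists_tendsto_floorAvg hγ hC (fun ℓ δ hδ => by
      obtain ⟨s, h1, h2, h3⟩ := exists_mem_Ico_of_ae
        (P := fun s => Tendsto (fun N : ℕ => birkhoffAverage ℂ (suspShift T γ) (suspExt T f) N
          (suspPoint T s x)) atTop (𝓝 (suspLimit T γ f (suspPoint T s x))))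
        (hx.mono fun t h k => (h k).1) ℓ δ hδ
      simp only [birkhoffAverage_suspPoint] at h3
      exact ⟨s, h1, h2, _, h3⟩) t
    have : suspLimit T γ f (suspPoint T t x) = L :=
      suspLimit_eq (by simp only [birkhoffAverage_suspPoint]; exact hL)
    rw [this]
    exact hL
  exact ⟨hlim, continuous_of_tendsto_floorAvg hγ hC hlim⟩

/-- The limit function `(t, x) ↦ F (t, x)` in the coordinates of `ℝ × X`. -/
noncomputable def limitFun (T : X ≃ᵐ X) (γ : ℝ) (f : X → ℂ) (t : ℝ) (x : X) : ℂ :=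
  suspLimit T γ f (suspPoint T t x)

lemma limitFun_add_one (t : ℝ) (x : X) :
    limitFun T γ f (t + 1) x = limitFun T γ f t (T x) := by
  rw [limitFun, suspPoint_add_one, limitFun]

lemma limitFun_add (t : ℝ) (x : X) : limitFun T γ f (t + γ) x = limitFun T γ f t x := by
  rw [limitFun, ← suspShift_suspPoint, suspLimit_suspShift, limitFun]

lemma measurable_limitFun (hfm : Measurable f) :
    Measurable fun p : ℝ × X => limitFun T γ f p.1 p.2 :=
  ((measurable_suspLimit hfm).mono (MeasurableSpace.invariants_le _) le_rfl).comp
    (measurable_suspPoint T)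

/-- Fatou's lemma applied to the averages, each of norm at most that of `f`. The bound holds at
every height `t`. -/
lemma eLpNorm_limitFun_le (hT : MeasurePreserving T μ μ) (hγ : Irrational γ) (hfm : Measurable f)
    (hf : MemLp f 2 μ) (t : ℝ) : eLpNorm (limitFun T γ f t) 2 μ ≤ eLpNorm f 2 μ := by
  have hm : ∀ N, AEStronglyMeasurable
      (fun x => floorAvg (fun k => f (intIter T k x)) γ N t) μ := fun N => by
    unfold floorAvg
    exact ((Finset.measurable_fun_sum _ fun n _ =>
      hfm.comp (measurable_intIter T _)).const_mul _).aestronglyMeasurable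
  refine (Lp.eLpNorm_lim_le_liminf_eLpNorm hm (limitFun T γ f t)
    ((ae_tendsto_floorAvg hT hγ hfm hf).mono fun x hx => hx.1 t)).trans ?_
  exact (liminf_le_liminf (Eventually.of_forall fun N => eLpNorm_floorAvg_le hT hfm N t)).trans
    (by simp)

lemma memLp_limitFun (hT : MeasurePreserving T μ μ) (hγ : Irrational γ) (hfm : Measurable f)
    (hf : MemLp f 2 μ) (s : Set ℝ) (hs : volume s ≠ ⊤) :
    MemLp (fun p : ℝ × X => limitFun T γ f p.1 p.2) 2 ((volume.restrict s).prod μ) := by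
  have hm := measurable_limitFun (T := T) (γ := γ) hfm
  refine ⟨hm.aestronglyMeasurable, ?_⟩
  rw [eLpNorm_lt_top_iff_lintegral_rpow_enorm_lt_top two_ne_zero ENNReal.ofNat_ne_top,
    lintegral_prod _ (hm.enorm.pow_const _).aemeasurable]
  have h1 : ∀ t, ∫⁻ x, ‖limitFun T γ f t x‖ₑ ^ (2 : ENNReal).toReal ∂μ
      ≤ eLpNorm f 2 μ ^ (2 : ENNReal).toReal := fun t => by
    have := ENNReal.rpow_le_rpow (eLpNorm_limitFun_le hT hγ hfm hf t)
      (z := (2 : ENNReal).toReal) (by positivity)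
    refine le_trans (le_of_eq ?_) this
    rw [eLpNorm_eq_lintegral_rpow_enorm_toReal two_ne_zero ENNReal.ofNat_ne_top,
      ← ENNReal.rpow_mul]
    norm_num
  refine (lintegral_mono h1).trans_lt ?_
  rw [lintegral_const, Measure.restrict_apply_univ]
  exact ENNReal.mul_lt_top (ENNReal.rpow_lt_top_of_nonneg (by positivity) hf.2.ne) hs.lt_top

end Pointwise

/-! ### Characters of `ℝ / pℤ` and functions with two periods. -/

section Wave

/-- The character `t ↦ exp(2πi m t / p)` of `ℝ / pℤ`. -/
noncomputable def wave (p : ℝ) (m : ℤ) (t : ℝ) : ℂ :=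
  Complex.exp (2 * Real.pi * Complex.I * (m * t / p))

variable {p : ℝ} {m : ℤ}

lemma wave_add (s t : ℝ) : wave p m (s + t) = wave p m s * wave p m t := by
  rw [wave, wave, wave, ← Complex.exp_add]
  congr 1
  push_cast
  ring

lemma wave_zero : wave p m 0 = 1 := by simp [wave]

lemma wave_one : wave p m 1 = Complex.exp (2 * Real.pi * Complex.I * (m / p)) := by simp [wave]

lemma wave_neg_mul (t : ℝ) : wave p m (-t) * wave p m t = 1 := by
  rw [← wave_add, neg_add_cancel, wave_zero]

lemma wave_mul_neg (t : ℝ) : wave p m t * wave p m (-t) = 1 := by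
  rw [← wave_add, add_neg_cancel, wave_zero]

lemma wave_ne_zero (t : ℝ) : wave p m t ≠ 0 := Complex.exp_ne_zero _

lemma conj_wave (t : ℝ) : conj (wave p m t) = wave p m (-t) := by
  rw [wave, wave, ← Complex.exp_conj]
  congr 1
  simp only [map_mul, map_div₀, map_ofNat, Complex.conj_I, Complex.conj_ofReal, map_intCast]
  push_cast
  ring

lemma norm_wave (t : ℝ) : ‖wave p m t‖ = 1 := by
  rw [wave, show (2 * Real.pi * Complex.I * (m * t / p) : ℂ)
    = ((2 * Real.pi * (m * t / p) : ℝ) : ℂ) * Complex.I by push_cast; ring]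
  exact Complex.norm_exp_ofReal_mul_I _

lemma wave_self (hp : p ≠ 0) : wave p m p = 1 := by
  have hp' : (p : ℂ) ≠ 0 := by exact_mod_cast hp
  rw [wave, mul_div_cancel_right₀ _ hp', Complex.exp_eq_one_iff]
  exact ⟨m, by ring⟩

lemma wave_period {γ : ℝ} (hp : p ≠ 0) (h : γ = p ∨ γ = -p) : wave p m γ = 1 := by
  rcases h with rfl | rfl
  · exact wave_self hp
  · have := wave_neg_mul (p := p) (m := m) p
    rwa [wave_self hp, mul_one] at this

lemma wave_periodic (hp : p ≠ 0) : Function.Periodic (wave p m) p := fun t => by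
  rw [wave_add, wave_self hp, mul_one]

lemma continuous_wave : Continuous (wave p m) := by
  unfold wave
  fun_prop

lemma integral_wave_neg (hp : p ≠ 0) : ∫ t in (0 : ℝ)..1, wave p m (-t) = eigenCoeff p m := by
  rw [eigenCoeff]
  split_ifs with hm
  · simp [hm, wave]
  · have hp' : (p : ℂ) ≠ 0 := by exact_mod_cast hp
    have hm' : (m : ℂ) ≠ 0 := by exact_mod_cast hm
    have hc : (-(2 * Real.pi * Complex.I * (m / p)) : ℂ) ≠ 0 :=
      neg_ne_zero.2 (mul_ne_zero Complex.two_pi_I_ne_zero (div_ne_zero hm' hp'))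
    have h := integral_exp_mul_complex (a := 0) (b := 1) hc
    rw [Complex.ofReal_one, mul_one, Complex.ofReal_zero, mul_zero, Complex.exp_zero] at h
    rw [← h]
    refine intervalIntegral.integral_congr fun t _ => ?_
    simp only [wave]
    congr 1
    push_cast
    ring

lemma integral_wave (hp : p ≠ 0) :
    ∫ t in (0 : ℝ)..1, wave p m t = conj (eigenCoeff p m) := by
  rw [← integral_wave_neg hp, intervalIntegral.integral_of_le zero_le_one,
    intervalIntegral.integral_of_le zero_le_one, ← integral_conj]
  simp only [conj_wave, neg_neg]

/-- The mean values of a function with two periods over these periods agree. -/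
lemma intervalIntegral_eq_mul_of_periodic (hp0 : 0 < p) {v : ℝ → ℂ} (hv : Measurable v) {B : ℝ}
    (hB : ∀ t, ‖v t‖ ≤ B) (h1 : Function.Periodic v 1) (hp : Function.Periodic v p) :
    ∫ t in (0 : ℝ)..p, v t = p * ∫ t in (0 : ℝ)..1, v t := by
  -- In either order one period makes the inner integral constant, so the double integral is
  -- computed in two ways.
  have hswap : ∫ s in (0 : ℝ)..1, ∫ t in (0 : ℝ)..p, v (s + t)
      = ∫ t in (0 : ℝ)..p, ∫ s in (0 : ℝ)..1, v (s + t) := by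
    simp only [intervalIntegral.integral_of_le zero_le_one, intervalIntegral.integral_of_le hp0.le]
    refine integral_integral_swap ?_
    exact Integrable.of_bound (hv.comp (measurable_fst.add measurable_snd)).aestronglyMeasurable B
      (Eventually.of_forall fun _ => hB _)
  have e1 : ∀ s, ∫ t in (0 : ℝ)..p, v (s + t) = ∫ t in (0 : ℝ)..p, v t := fun s => by
    rw [intervalIntegral.integral_comp_add_left, add_zero, hp.intervalIntegral_add_eq s 0, zero_add]
  have e2 : ∀ t, ∫ s in (0 : ℝ)..1, v (s + t) = ∫ s in (0 : ℝ)..1, v s := fun t => by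
    rw [intervalIntegral.integral_comp_add_right, zero_add, add_comm (1 : ℝ) t,
      h1.intervalIntegral_add_eq t 0, zero_add]
  simp only [e1, e2, intervalIntegral.integral_const, sub_zero, one_smul] at hswap
  rw [hswap, Complex.real_smul]

end Wave

/-! ### Eigenfunctions of `T` and their invariant extensions to the suspension. -/

section Eigenfunctions

variable {X : Type*} [MeasurableSpace X] {μ : Measure X} {T : X ≃ᵐ X} {p : ℝ} {m : ℤ}

lemma koopman_coeFn (hT : MeasurePreserving T μ μ) (w : Lp ℂ 2 μ) :
    koopman hT w =ᵐ[μ] fun x => w (T x) :=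
  Lp.coeFn_compMeasurePreserving w hT

lemma mem_eigenspace_iff (hT : MeasurePreserving T μ μ) (w : Lp ℂ 2 μ) :
    w ∈ eigenspace hT p m ↔ ∀ᵐ x ∂μ, w (T x) = wave p m 1 * w x := by
  rw [eigenspace, Module.End.mem_eigenspace_iff, ← wave_one]
  constructor
  · intro h
    have h' : koopman hT w = wave p m 1 • w := h
    have h2 := koopman_coeFn hT w
    rw [h'] at h2
    filter_upwards [h2, Lp.coeFn_smul (wave p m 1) w] with x h3 h4
    rw [← h3, h4]; rfl
  · intro h
    change koopman hT w = wave p m 1 • w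
    refine Lp.ext ?_
    filter_upwards [koopman_coeFn hT w, Lp.coeFn_smul (wave p m 1) w, h] with x h2 h3 h4
    rw [h2, h3, h4]; rfl

/-- An `L²` eigenfunction has a version that is an eigenfunction everywhere. -/
lemma exists_eigenfunction (hT : MeasurePreserving T μ μ) {w : Lp ℂ 2 μ}
    (hw : w ∈ eigenspace hT p m) :
    ∃ g : X → ℂ, Measurable g ∧ (∀ x, g (T x) = wave p m 1 * g x) ∧ w =ᵐ[μ] g := by
  have hwm : Measurable w := (Lp.stronglyMeasurable w).measurable
  -- Requiring the equation along the whole orbit makes `A` invariant, so replacing `w` by `0` off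
  -- `A` preserves it.
  set A : Set X := {x | ∀ k : ℤ, w (intIter T (k + 1) x) = wave p m 1 * w (intIter T k x)}
  have hA : MeasurableSet A := by
    have : A = ⋂ k : ℤ, {x | w (intIter T (k + 1) x) = wave p m 1 * w (intIter T k x)} := by
      ext x; simp [A]
    rw [this]
    exact MeasurableSet.iInter fun k => measurableSet_eq_fun
      (hwm.comp (measurable_intIter T _)) ((hwm.comp (measurable_intIter T _)).const_mul _)
  have hTA : ∀ x, T x ∈ A ↔ x ∈ A := fun x => by
    simp only [A, Set.mem_ofPred_eq, ← intIter_add_one]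
    exact ⟨fun h k => by simpa using h (k - 1), fun h k => h (k + 1)⟩
  have hae : ∀ᵐ x ∂μ, x ∈ A := by
    refine ae_all_iff.2 fun k => ?_
    filter_upwards [(measurePreserving_intIter hT k).quasiMeasurePreserving.ae
      ((mem_eigenspace_iff hT w).1 hw)] with x hx
    rw [intIter_succ, hx]
  refine ⟨A.indicator w, hwm.indicator hA, fun x => ?_, ?_⟩
  · by_cases hx : x ∈ A
    · rw [Set.indicator_of_mem hx, Set.indicator_of_mem ((hTA x).2 hx)]
      have := hx 0
      rwa [zero_add, intIter_zero] at this
    · rw [Set.indicator_of_notMem hx, Set.indicator_of_notMem (mt (hTA x).1 hx), mul_zero]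
  · filter_upwards [hae] with x hx
    rw [Set.indicator_of_mem hx]

lemma eigenfunction_intIter {g : X → ℂ} (hg : ∀ x, g (T x) = wave p m 1 * g x) (k : ℤ) (x : X) :
    g (intIter T k x) = wave p m k * g x := by
  have hstep : ∀ k : ℤ, g (intIter T (k + 1) x) = wave p m 1 * g (intIter T k x) := fun k => by
    rw [intIter_succ, hg]
  induction k with
  | zero => rw [intIter_zero, Int.cast_zero, wave_zero, one_mul]
  | succ n ih =>
    rw [hstep, ih, Int.cast_add, wave_add, Int.cast_one]
    ring
  | pred n ih =>
    have h := hstep (-n - 1)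
    rw [sub_add_cancel, ih] at h
    apply mul_left_cancel₀ (wave_ne_zero (p := p) (m := m) 1)
    rw [← h, ← mul_assoc, ← wave_add]
    congr 2
    push_cast
    ring

/-- The extension `(t, x) ↦ exp(2πi m t / p) g x` of an eigenfunction `g` to the suspension. -/
noncomputable def suspEigen (T : X ≃ᵐ X) (p : ℝ) (m : ℤ) {g : X → ℂ}
    (hg : ∀ x, g (T x) = wave p m 1 * g x) : Susp T → ℂ :=
  Quot.lift (fun q : unitInterval × X => wave p m q.1 * g q.2) (by
    rintro _ _ ⟨x, rfl, rfl⟩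
    simp [hg, wave_zero])

variable {g : X → ℂ} (hg : ∀ x, g (T x) = wave p m 1 * g x)

lemma suspEigen_suspPoint (t : ℝ) (x : X) :
    suspEigen T p m hg (suspPoint T t x) = wave p m t * g x := by
  have h : suspEigen T p m hg (suspPoint T t x)
      = wave p m (Int.fract t) * g (intIter T ⌊t⌋ x) := rfl
  rw [h, eigenfunction_intIter hg, ← mul_assoc, ← wave_add, Int.fract_add_floor]

/-- The character equals `1` at `±p`, hence at `γ`. These functions are the invariant test functions
against which the conditional expectation is paired. -/
lemma measurable_suspEigen (hgm : Measurable g) {γ : ℝ} (hp : p ≠ 0) (h : γ = p ∨ γ = -p) :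
    Measurable[MeasurableSpace.invariants (suspShift T γ)] (suspEigen T p m hg) := by
  rw [MeasurableSpace.measurable_invariants_dom]
  refine ⟨measurable_of_comp_suspPoint T ?_, fun s _ => ?_⟩
  · simp only [suspEigen_suspPoint]
    exact (continuous_wave.measurable.comp measurable_fst).mul (hgm.comp measurable_snd)
  · have : suspEigen T p m hg ∘ suspShift T γ = suspEigen T p m hg := by
      funext y
      obtain ⟨t, x, rfl⟩ := exists_suspPoint_eq T y
      rw [Function.comp_apply, suspShift_suspPoint, suspEigen_suspPoint, suspEigen_suspPoint,
        wave_add, wave_period hp h, mul_one]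
    rw [this]

end Eigenfunctions

/-! ### Fourier coefficients of the limit as projections to eigenspaces. -/

section FourierCoefficients

lemma inner_toLp {α : Type*} [MeasurableSpace α] {κ : Measure α} {f g : α → ℂ}
    (hf : MemLp f 2 κ) (hg : MemLp g 2 κ) :
    inner ℂ (hf.toLp f) (hg.toLp g) = ∫ x, g x * conj (f x) ∂κ := by
  rw [L2.inner_def]
  refine integral_congr_ae ?_
  filter_upwards [hf.coeFn_toLp, hg.coeFn_toLp] with x h1 h2
  rw [h1, h2, RCLike.inner_apply]

/-- Cauchy–Schwarz against the constant `1`, obtained by expanding the variance of `‖h‖`. -/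
lemma sq_integral_norm_le {p : ℝ} (hp : 0 < p) {h : ℝ → ℂ}
    (hh : MemLp h 2 (volume.restrict (Set.Ioc 0 p))) :
    (∫ s in Set.Ioc 0 p, ‖h s‖) ^ 2 ≤ p * ∫ s in Set.Ioc 0 p, ‖h s‖ ^ 2 := by
  have h1 : Integrable (fun s => ‖h s‖) (volume.restrict (Set.Ioc 0 p)) :=
    (hh.integrable one_le_two).norm
  have h2 : Integrable (fun s => ‖h s‖ ^ 2) (volume.restrict (Set.Ioc 0 p)) :=
    (memLp_two_iff_integrable_sq_norm hh.1).1 hh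
  set I := ∫ s in Set.Ioc 0 p, ‖h s‖
  have h0 : 0 ≤ ∫ s in Set.Ioc 0 p, (‖h s‖ - I / p) ^ 2 := integral_nonneg fun s => sq_nonneg _
  have h3 : ∫ s in Set.Ioc 0 p, (‖h s‖ - I / p) ^ 2
      = (∫ s in Set.Ioc 0 p, ‖h s‖ ^ 2) - 2 * (I / p) * I + p * (I / p) ^ 2 := by
    have e : ∀ s, (‖h s‖ - I / p) ^ 2 = ‖h s‖ ^ 2 - 2 * (I / p) * ‖h s‖ + (I / p) ^ 2 :=
      fun s => by ring
    have i1 : Integrable (fun s => ‖h s‖ ^ 2 - 2 * (I / p) * ‖h s‖)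
        (volume.restrict (Set.Ioc 0 p)) := h2.sub (h1.const_mul _)
    simp only [e]
    rw [integral_add i1 (integrable_const _),
      integral_sub h2 (h1.const_mul _), integral_const_mul]
    rw [integral_const, show ∫ s in Set.Ioc 0 p, ‖h s‖ = I from rfl]
    simp [hp.le]
  rw [h3] at h0
  have h4 : p * ((∫ s in Set.Ioc 0 p, ‖h s‖ ^ 2) - 2 * (I / p) * I + p * (I / p) ^ 2)
      = p * (∫ s in Set.Ioc 0 p, ‖h s‖ ^ 2) - I ^ 2 := by
    field_simp
    ring
  have := mul_nonneg hp.le h0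
  linarith

variable {X : Type*} [MeasurableSpace X] {T : X ≃ᵐ X} {γ p : ℝ} {m : ℤ} {f : X → ℂ}

/-- The Fourier coefficient of the `p`-periodic function `t ↦ F (t, x)`. -/
noncomputable def waveCoeff (T : X ≃ᵐ X) (γ : ℝ) (f : X → ℂ) (p : ℝ) (m : ℤ) (x : X) : ℂ :=
  (1 / p) * ∫ s in (0 : ℝ)..p, wave p m (-s) * limitFun T γ f s x

lemma limitFun_periodic (h : γ = p ∨ γ = -p) (x : X) :
    Function.Periodic (fun t => limitFun T γ f t x) p := by
  have h1 : Function.Periodic (fun t => limitFun T γ f t x) γ := fun t => limitFun_add t x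
  rcases h with rfl | rfl
  · exact h1
  · simpa using h1.neg

/-- Passing from `x` to `T x` translates the `p`-periodic function by one, which multiplies its
coefficient by the value of the character at `1`. -/
lemma waveCoeff_apply (hp : p ≠ 0) (h : γ = p ∨ γ = -p) (x : X) :
    waveCoeff T γ f p m (T x) = wave p m 1 * waveCoeff T γ f p m x := by
  have hper : Function.Periodic (fun s => wave p m (-s) * limitFun T γ f s x) p := by
    refine Function.Periodic.mul (fun s => ?_) (limitFun_periodic h x)
    have := (wave_periodic (p := p) (m := m) hp).neg (-s)
    rwa [← neg_add] at this
  have e1 : ∀ s, wave p m (-s) * limitFun T γ f s (T x)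
      = wave p m 1 * (wave p m (-(s + 1)) * limitFun T γ f (s + 1) x) := fun s => by
    rw [limitFun_add_one, ← mul_assoc, ← wave_add]
    congr 2
    ring
  have e2 := hper.intervalIntegral_add_eq 1 0
  rw [zero_add] at e2
  simp only [waveCoeff, e1]
  rw [intervalIntegral.integral_const_mul, intervalIntegral.integral_comp_add_right
    (fun s => wave p m (-s) * limitFun T γ f s x), zero_add, add_comm p 1, e2]
  ring

lemma measurable_wave_mul_limitFun (hfm : Measurable f) :
    Measurable fun q : ℝ × X => wave p m (-q.1) * limitFun T γ f q.1 q.2 :=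
  (continuous_wave.measurable.comp measurable_fst.neg).mul (measurable_limitFun hfm)

lemma measurable_waveCoeff (hp : 0 < p) (hfm : Measurable f) :
    Measurable (waveCoeff T γ f p m) := by
  have h := (measurable_wave_mul_limitFun (T := T) (γ := γ) (p := p) (m := m)
    hfm).stronglyMeasurable.integral_prod_left' (μ := volume.restrict (Set.Ioc 0 p))
  have : waveCoeff T γ f p m = fun x => (1 / (p : ℂ)) * ∫ s in Set.Ioc 0 p,
      wave p m (-s) * limitFun T γ f s x := by
    funext x
    rw [waveCoeff, intervalIntegral.integral_of_le hp.le]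
  rw [this]
  exact h.measurable.const_mul _

variable {μ : Measure X} [IsProbabilityMeasure μ]

lemma memLp_waveCoeff (hT : MeasurePreserving T μ μ) (hγ : Irrational γ) (hp : 0 < p)
    (hfm : Measurable f) (hf : MemLp f 2 μ) : MemLp (waveCoeff T γ f p m) 2 μ := by
  have hG := (measurable_waveCoeff (T := T) (γ := γ) (m := m) hp hfm).aestronglyMeasurable (μ := μ)
  have hH := memLp_limitFun hT hγ hfm hf (Set.Ioc 0 p) (by simp)
  have hH2 := (memLp_two_iff_integrable_sq_norm hH.1).1 hH
  rw [memLp_two_iff_integrable_sq_norm hG]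
  refine Integrable.mono' (hH2.integral_prod_right.const_mul p⁻¹)
    (hG.norm.pow 2) ?_
  filter_upwards [hH2.prod_left_ae] with x hx
  have hmx : AEStronglyMeasurable (fun s => limitFun T γ f s x) (volume.restrict (Set.Ioc 0 p)) :=
    ((measurable_limitFun hfm).comp measurable_prodMk_right).aestronglyMeasurable
  have h1 := sq_integral_norm_le hp ((memLp_two_iff_integrable_sq_norm hmx).2 hx)
  have h2 : ‖waveCoeff T γ f p m x‖ ≤ p⁻¹ * ∫ s in Set.Ioc 0 p, ‖limitFun T γ f s x‖ := by
    rw [waveCoeff, norm_mul, intervalIntegral.integral_of_le hp.le, one_div, norm_inv,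
      Complex.norm_real, Real.norm_of_nonneg hp.le]
    refine mul_le_mul_of_nonneg_left ((norm_integral_le_integral_norm _).trans (le_of_eq ?_))
      (inv_nonneg.2 hp.le)
    simp only [norm_mul, norm_wave, one_mul]
  rw [norm_pow, norm_norm]
  calc ‖waveCoeff T γ f p m x‖ ^ 2
      ≤ (p⁻¹ * ∫ s in Set.Ioc 0 p, ‖limitFun T γ f s x‖) ^ 2 :=
        pow_le_pow_left₀ (norm_nonneg _) h2 2
    _ = p⁻¹ ^ 2 * (∫ s in Set.Ioc 0 p, ‖limitFun T γ f s x‖) ^ 2 := mul_pow _ _ _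
    _ ≤ p⁻¹ ^ 2 * (p * ∫ s in Set.Ioc 0 p, ‖limitFun T γ f s x‖ ^ 2) :=
        mul_le_mul_of_nonneg_left h1 (sq_nonneg _)
    _ = p⁻¹ * ∫ s in Set.Ioc 0 p, ‖limitFun T γ f s x‖ ^ 2 := by
        field_simp

variable {g : X → ℂ}

/-- Pairing of `F` with an invariant function on the suspension. -/
lemma integral_limitFun_mul (hT : MeasurePreserving T μ μ) (hp : p ≠ 0) (h : γ = p ∨ γ = -p)
    (hfm : Measurable f) (hf : MemLp f 2 μ) (hgm : Measurable g) (hg2 : MemLp g 2 μ)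
    (hg : ∀ x, g (T x) = wave p m 1 * g x) (hH : MemLp (fun q : ℝ × X => limitFun T γ f q.1 q.2) 2
      ((volume.restrict (Set.Ioc 0 1)).prod μ)) :
    ∫ t in (0 : ℝ)..1, wave p m t * ∫ x, g x * conj (limitFun T γ f t x) ∂μ
      = conj (eigenCoeff p m) * ∫ x, g x * conj (f x) ∂μ := by
  set ν := suspMeasure T μ
  have hI := MeasurableSpace.invariants_le (suspShift T γ)
  have hΨI := measurable_suspEigen (T := T) hg hgm hp h
  have hΨm : Measurable (suspEigen T p m hg) := hΨI.mono hI le_rfl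
  have hw : MemLp (fun q : ℝ × X => wave p m q.1 * g q.2) 2
      ((volume.restrict (Set.Ioc (0 : ℝ) 1)).prod μ) := by
    refine (hg2.comp_snd (volume.restrict (Set.Ioc (0 : ℝ) 1))).of_le
      ((continuous_wave.measurable.comp measurable_fst).mul
        (hgm.comp measurable_snd)).aestronglyMeasurable (Eventually.of_forall fun q => ?_)
    rw [norm_mul, norm_wave, one_mul]
  have hΨ : MemLp (suspEigen T p m hg) 2 ν := by
    rw [show ν = _ from map_suspPoint.symm, memLp_map_measure_iff hΨm.aestronglyMeasurable
      (measurable_suspPoint T).aemeasurable]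
    refine hw.ae_eq (Eventually.of_forall fun q => ?_)
    exact (suspEigen_suspPoint hg q.1 q.2).symm
  have hfL := memLp_suspExt (T := T) hfm hf
  have hFm : Measurable (suspLimit T γ f) := (measurable_suspLimit hfm).mono hI le_rfl
  have hcond : suspLimit T γ f =ᵐ[ν] condExpL2 ℂ ℂ hI (hfL.toLp _) := by
    filter_upwards [ae_tendsto_suspLimit (γ := γ) hT hfm hf, hfL.condExpL2_ae_eq_condExp (𝕜 := ℂ) hI]
      with y h1 h2
    rw [h1.2, h2]
  have hF : MemLp (suspLimit T γ f) 2 ν := (Lp.memLp _).ae_eq hcond.symm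
  -- `F` is the orthogonal projection of `f̃` to the invariant functions, and the extended
  -- eigenfunction is one of these.
  have key : inner ℂ (hF.toLp _) (hΨ.toLp _) = inner ℂ (hfL.toLp _) (hΨ.toLp _) := by
    have h1 : hF.toLp _ = (condExpL2 ℂ ℂ hI (hfL.toLp _) : Lp ℂ 2 ν) :=
      Lp.ext (hF.coeFn_toLp.trans hcond)
    rw [h1]
    refine inner_condExpL2_eq_inner_fun hI _ _ ?_
    exact (hΨI.stronglyMeasurable.aestronglyMeasurable).congr hΨ.coeFn_toLp.symm
  have hmap : ∀ φ : Susp T → ℂ, Measurable φ → ∫ y, φ y ∂ν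
      = ∫ q : ℝ × X, φ (suspPoint T q.1 q.2) ∂((volume.restrict (Set.Ioc 0 1)).prod μ) :=
    fun φ hφ => by
      rw [show ν = _ from map_suspPoint.symm,
        integral_map (measurable_suspPoint T).aemeasurable hφ.aestronglyMeasurable]
  rw [inner_toLp, inner_toLp,
    hmap (fun y => suspEigen T p m hg y * conj (suspLimit T γ f y))
      (hΨm.mul (Complex.continuous_conj.measurable.comp hFm)),
    hmap (fun y => suspEigen T p m hg y * conj (suspExt T f y))
      (hΨm.mul (Complex.continuous_conj.measurable.comp (measurable_suspExt T hfm)))] at key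
  simp only [suspEigen_suspPoint] at key
  have hR : ∫ q : ℝ × X, wave p m q.1 * g q.2 * conj (suspExt T f (suspPoint T q.1 q.2))
        ∂((volume.restrict (Set.Ioc 0 1)).prod μ)
      = conj (eigenCoeff p m) * ∫ x, g x * conj (f x) ∂μ := by
    rw [← integral_wave hp, intervalIntegral.integral_of_le zero_le_one, ← integral_prod_mul]
    refine integral_congr_ae ?_
    filter_upwards [suspExt_suspPoint_ae (T := T) (μ := μ) f] with q hq
    rw [hq, mul_assoc]
  have hL : ∫ q : ℝ × X, wave p m q.1 * g q.2 * conj (suspLimit T γ f (suspPoint T q.1 q.2))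
        ∂((volume.restrict (Set.Ioc 0 1)).prod μ)
      = ∫ t in (0 : ℝ)..1, wave p m t * ∫ x, g x * conj (limitFun T γ f t x) ∂μ := by
    rw [intervalIntegral.integral_of_le zero_le_one, integral_prod]
    · refine integral_congr_ae (Eventually.of_forall fun t => ?_)
      simp only [mul_assoc]
      rw [integral_const_mul]
      rfl
    · exact hw.integrable_mul hH.star
  rw [← hL, key, hR]

/-- Pairing of a Fourier coefficient of `F` with an eigenfunction. -/
lemma integral_mul_conj_waveCoeff (hT : MeasurePreserving T μ μ) (hγ : Irrational γ) (hp : 0 < p)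
    (h : γ = p ∨ γ = -p) (hfm : Measurable f) (hf : MemLp f 2 μ) (hgm : Measurable g)
    (hg2 : MemLp g 2 μ) (hg : ∀ x, g (T x) = wave p m 1 * g x) :
    ∫ x, g x * conj (waveCoeff T γ f p m x) ∂μ
      = conj (eigenCoeff p m) * ∫ x, g x * conj (f x) ∂μ := by
  have hHm := measurable_limitFun (T := T) (γ := γ) hfm
  set u : ℝ → ℂ := fun t => ∫ x, g x * conj (limitFun T γ f t x) ∂μ
  set v : ℝ → ℂ := fun t => wave p m t * u t
  have hum : Measurable u := by
    have : Measurable fun q : ℝ × X => g q.2 * conj (limitFun T γ f q.1 q.2) :=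
      (hgm.comp measurable_snd).mul (Complex.continuous_conj.measurable.comp hHm)
    exact this.stronglyMeasurable.integral_prod_right.measurable
  have hvm : Measurable v := continuous_wave.measurable.mul hum
  have hHt : ∀ t, MemLp (limitFun T γ f t) 2 μ := fun t =>
    ⟨(hHm.comp measurable_prodMk_left).aestronglyMeasurable,
      (eLpNorm_limitFun_le hT hγ hfm hf t).trans_lt hf.2⟩
  have hvB : ∀ t, ‖v t‖ ≤ ‖hf.toLp f‖ * ‖hg2.toLp g‖ := fun t => by
    have h1 : u t = inner ℂ ((hHt t).toLp _) (hg2.toLp g) := (inner_toLp _ _).symm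
    rw [norm_mul, norm_wave, one_mul, h1]
    refine (norm_inner_le_norm _ _).trans (mul_le_mul_of_nonneg_right ?_ (norm_nonneg _))
    rw [Lp.norm_toLp, Lp.norm_toLp]
    exact ENNReal.toReal_mono hf.2.ne (eLpNorm_limitFun_le hT hγ hfm hf t)
  -- Invariance of `μ` gives `u` the inverse of the factor that the character acquires over a unit
  -- step.
  have hv1 : Function.Periodic v 1 := fun t => by
    have h1 : u (t + 1) = wave p m (-1) * u t := by
      have h2 : ∫ x, g (T x) * conj (limitFun T γ f t (T x)) ∂μ = u t :=
        hT.integral_comp T.measurableEmbedding (fun x => g x * conj (limitFun T γ f t x))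
      rw [← h2, ← integral_const_mul]
      refine integral_congr_ae (Eventually.of_forall fun x => ?_)
      simp only [limitFun_add_one, hg]
      rw [← mul_assoc, ← mul_assoc, wave_neg_mul, one_mul]
    simp only [v]
    rw [h1, wave_add]
    calc wave p m t * wave p m 1 * (wave p m (-1) * u t)
        = wave p m t * (wave p m 1 * wave p m (-1)) * u t := by ring
      _ = _ := by rw [wave_mul_neg, mul_one]
  have hvp : Function.Periodic v p := fun t => by
    have h1 : u (t + p) = u t := by
      simp only [u]
      congr 1
      funext x
      have := limitFun_periodic (T := T) (f := f) h x t
      simp only at this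
      rw [this]
    simp only [v]
    rw [h1, wave_periodic hp.ne']
  -- The Fourier coefficient averages over `[0, p]`, while the measure of the suspension uses `[0,
  -- 1]`; the two periods of `v` identify the means.
  have hint := intervalIntegral_eq_mul_of_periodic hp hvm hvB hv1 hvp
  rw [integral_limitFun_mul hT hp.ne' h hfm hf hgm hg2 hg
    (memLp_limitFun hT hγ hfm hf _ (by simp)), intervalIntegral.integral_of_le hp.le] at hint
  have hp' : (p : ℂ) ≠ 0 := by exact_mod_cast hp.ne'
  have hw : MemLp (fun q : ℝ × X => wave p m q.1 * g q.2) 2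
      ((volume.restrict (Set.Ioc (0 : ℝ) p)).prod μ) := by
    refine (hg2.comp_snd (volume.restrict (Set.Ioc (0 : ℝ) p))).of_le
      ((continuous_wave.measurable.comp measurable_fst).mul
        (hgm.comp measurable_snd)).aestronglyMeasurable (Eventually.of_forall fun q => ?_)
    rw [norm_mul, norm_wave, one_mul]
  have hprod : Integrable (fun q : ℝ × X => wave p m q.1 * g q.2 * conj (limitFun T γ f q.1 q.2))
      ((volume.restrict (Set.Ioc (0 : ℝ) p)).prod μ) :=
    hw.integrable_mul (memLp_limitFun hT hγ hfm hf _ (by simp)).star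
  have e1 : ∫ t in Set.Ioc 0 p, v t
      = ∫ x, (∫ t in Set.Ioc 0 p, wave p m t * g x * conj (limitFun T γ f t x)) ∂μ := by
    rw [← integral_integral_swap hprod]
    refine integral_congr_ae (Eventually.of_forall fun t => ?_)
    simp only [mul_assoc, v, u]
    rw [integral_const_mul]
  have e2 : ∀ x, g x * conj (waveCoeff T γ f p m x)
      = (1 / p) * ∫ t in Set.Ioc 0 p, wave p m t * g x * conj (limitFun T γ f t x) := fun x => by
    rw [waveCoeff, intervalIntegral.integral_of_le hp.le, map_mul, ← integral_conj, map_div₀,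
      map_one, Complex.conj_ofReal, mul_left_comm, ← integral_const_mul]
    congr 2
    funext t
    rw [map_mul, conj_wave, neg_neg]
    ring
  simp only [e2]
  rw [integral_const_mul, ← e1, hint]
  field_simp

/-- The coefficient lies in the eigenspace, and its difference from `c_m f` is orthogonal to every
eigenfunction; this characterises the projection of `c_m f`. -/
lemma waveCoeff_ae_eq (hT : MeasurePreserving T μ μ) (hγ : Irrational γ) (hp : 0 < p)
    (h : γ = p ∨ γ = -p) (hfm : Measurable f) (hf : MemLp f 2 μ) :
    waveCoeff T γ f p m =ᵐ[μ] fun x => eigenCoeff p m * eigenProj hT p m (hf.toLp f) x := by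
  have hG := memLp_waveCoeff (m := m) hT hγ hp hfm hf
  have hmem : hG.toLp _ ∈ eigenspace hT p m := by
    rw [mem_eigenspace_iff]
    filter_upwards [hG.coeFn_toLp, hT.quasiMeasurePreserving.ae hG.coeFn_toLp] with x h1 h2
    rw [h1, h2, waveCoeff_apply hp.ne' h]
  have horth : ∀ w ∈ eigenspace hT p m,
      inner ℂ (eigenCoeff p m • hf.toLp f - hG.toLp _) w = 0 := fun w hw => by
    obtain ⟨g, hgm, hg, hwg⟩ := exists_eigenfunction hT hw
    have hg2 : MemLp g 2 μ := (Lp.memLp w).ae_eq hwg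
    have hw' : w = hg2.toLp g := Lp.ext (hwg.trans hg2.coeFn_toLp.symm)
    rw [hw', inner_sub_left, inner_smul_left, inner_toLp, inner_toLp,
      integral_mul_conj_waveCoeff hT hγ hp h hfm hf hgm hg2 hg, sub_self]
  have hproj := Submodule.eq_starProjection_of_mem_of_inner_eq_zero hmem horth
  rw [map_smul] at hproj
  have h1 : eigenCoeff p m • eigenProj hT p m (hf.toLp f) = hG.toLp _ := hproj
  filter_upwards [hG.coeFn_toLp, Lp.coeFn_smul (eigenCoeff p m) (eigenProj hT p m (hf.toLp f))]
    with x h2 h3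
  rw [← h2, ← h1, h3]
  rfl

end FourierCoefficients

/-! ### Orthogonality of the eigenspaces and Bessel's inequality. -/

section Bessel

variable {X : Type*} [MeasurableSpace X] {μ : Measure X} {T : X ≃ᵐ X} {p : ℝ}

lemma wave_one_ne_one (hp : Irrational p) {k : ℤ} (hk : k ≠ 0) : wave p k 1 ≠ 1 := by
  intro h
  rw [wave_one, Complex.exp_eq_one_iff] at h
  obtain ⟨n, hn⟩ := h
  have h1 : ((k : ℂ) / p) = n := by
    apply mul_left_cancel₀ Complex.two_pi_I_ne_zero
    rw [hn]; ring
  have h2 : (k : ℝ) / p = n := by exact_mod_cast h1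
  rw [div_eq_iff hp.ne_zero] at h2
  have hn0 : n ≠ 0 := by
    rintro rfl
    simp [hk] at h2
  exact (hp.intCast_mul hn0).ne_int k h2.symm

/-- Composition with `T` is an isometry, and irrationality of `p` makes the unimodular eigenvalues
for `m ≠ n` distinct. -/
lemma inner_eigenspace_eq_zero (hT : MeasurePreserving T μ μ) (hp : Irrational p) {m n : ℤ}
    (hmn : m ≠ n) {v w : Lp ℂ 2 μ} (hv : v ∈ eigenspace hT p m) (hw : w ∈ eigenspace hT p n) :
    inner ℂ v w = 0 := by
  have hv' : koopman hT v = wave p m 1 • v := by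
    rw [wave_one]; exact Module.End.mem_eigenspace_iff.1 hv
  have hw' : koopman hT w = wave p n 1 • w := by
    rw [wave_one]; exact Module.End.mem_eigenspace_iff.1 hw
  have h1 : inner ℂ (koopman hT v) (koopman hT w) = inner ℂ v w :=
    LinearIsometry.inner_map_map (Lp.compMeasurePreservingₗᵢ ℂ T hT) v w
  rw [hv', hw', inner_smul_left, inner_smul_right, conj_wave, ← mul_assoc] at h1
  have h2 : wave p m (-1) * wave p n 1 = wave p (n - m) 1 := by
    rw [wave, wave, wave, ← Complex.exp_add]
    congr 1
    push_cast
    ring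
  rw [h2] at h1
  have h3 : (wave p (n - m) 1 - 1) * inner ℂ v w = 0 := by
    rw [sub_mul, h1, one_mul, sub_self]
  exact (mul_eq_zero.1 h3).resolve_left
    (sub_ne_zero.2 (wave_one_ne_one hp (sub_ne_zero.2 hmn.symm)))

lemma summable_norm_sq_eigenProj (hT : MeasurePreserving T μ μ) (hp : Irrational p)
    (w : Lp ℂ 2 μ) : Summable fun m : ℤ => ‖eigenProj hT p m w‖ ^ 2 := by
  refine summable_of_sum_le (c := ‖w‖ ^ 2) (fun m => sq_nonneg _) fun s => ?_
  -- Both `⟨S, S⟩` and `⟨S, w⟩` equal the partial sum, so `‖S‖² ≤ ‖S‖ ‖w‖`.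
  set S := ∑ m ∈ s, eigenProj hT p m w
  have hmem : ∀ m, eigenProj hT p m w ∈ eigenspace hT p m := fun m =>
    Submodule.starProjection_apply_mem _ _
  have hself : ∀ m, inner ℂ (eigenProj hT p m w) (eigenProj hT p m w)
      = ((‖eigenProj hT p m w‖ ^ 2 : ℝ) : ℂ) := fun m => by
    rw [inner_self_eq_norm_sq_to_K]; push_cast; rfl
  have h1 : inner ℂ S S = ((∑ m ∈ s, ‖eigenProj hT p m w‖ ^ 2 : ℝ) : ℂ) := by
    rw [Complex.ofReal_sum, sum_inner]
    refine Finset.sum_congr rfl fun m hm => ?_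
    rw [inner_sum, Finset.sum_eq_single_of_mem m hm, hself]
    exact fun n _ hn => inner_eigenspace_eq_zero hT hp hn.symm (hmem m) (hmem n)
  have h2 : inner ℂ S w = ((∑ m ∈ s, ‖eigenProj hT p m w‖ ^ 2 : ℝ) : ℂ) := by
    rw [Complex.ofReal_sum, sum_inner]
    refine Finset.sum_congr rfl fun m _ => ?_
    rw [← hself]
    have h3 : inner ℂ (w - eigenProj hT p m w) (eigenProj hT p m w) = 0 :=
      Submodule.starProjection_inner_eq_zero w _ (hmem m)
    have h4 := congrArg conj h3
    rw [inner_conj_symm, map_zero, inner_sub_right] at h4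
    exact sub_eq_zero.1 h4
  set A := ∑ m ∈ s, ‖eigenProj hT p m w‖ ^ 2
  have h3 : A = ‖S‖ ^ 2 := by
    have : ((A : ℝ) : ℂ) = ((‖S‖ ^ 2 : ℝ) : ℂ) := by
      rw [← h1, inner_self_eq_norm_sq_to_K]; push_cast; rfl
    exact_mod_cast this
  have h4 : A ≤ ‖S‖ * ‖w‖ := by
    have h5 := norm_inner_le_norm (𝕜 := ℂ) S w
    rw [h2, Complex.norm_real] at h5
    exact (le_abs_self _).trans h5
  rw [h3] at h4 ⊢
  have h5 := norm_nonneg S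
  have h6 := norm_nonneg w
  have h7 : ‖S‖ ≤ ‖w‖ := by
    rcases h5.eq_or_lt with h | h
    · rw [← h]; exact h6
    · rw [sq] at h4; exact le_of_mul_le_mul_left h4 h
  exact pow_le_pow_left₀ h5 h7 2

/-- By Tonelli the sum of the pointwise squares has finite integral, hence is finite almost
everywhere. -/
lemma ae_summable_norm_sq {w : ℤ → Lp ℂ 2 μ} (hw : Summable fun m => ‖w m‖ ^ 2) :
    ∀ᵐ x ∂μ, Summable fun m => ‖w m x‖ ^ 2 := by
  have hint : ∀ m, ∫⁻ x, ENNReal.ofReal (‖w m x‖ ^ 2) ∂μ = ENNReal.ofReal (‖w m‖ ^ 2) := fun m => by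
    have hi := (memLp_two_iff_integrable_sq_norm (Lp.memLp (w m)).1).1 (Lp.memLp (w m))
    rw [← ofReal_integral_eq_lintegral_ofReal hi (Eventually.of_forall fun x => sq_nonneg _)]
    congr 1
    have h1 : inner ℂ (w m) (w m) = ((‖w m‖ ^ 2 : ℝ) : ℂ) := by
      rw [inner_self_eq_norm_sq_to_K]; push_cast; rfl
    have h2 : inner ℂ (w m) (w m) = ((∫ x, ‖w m x‖ ^ 2 ∂μ : ℝ) : ℂ) := by
      rw [L2.inner_def, ← integral_complex_ofReal]
      refine integral_congr_ae (Eventually.of_forall fun x => ?_)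
      simp only [inner_self_eq_norm_sq_to_K]
      push_cast
      rfl
    exact_mod_cast h2.symm.trans h1
  have hmeas : ∀ m, AEMeasurable (fun x => ENNReal.ofReal (‖w m x‖ ^ 2)) μ := fun m =>
    ((Lp.stronglyMeasurable (w m)).norm.measurable.pow_const 2).ennreal_ofReal.aemeasurable
  have hfin : ∫⁻ x, ∑' m, ENNReal.ofReal (‖w m x‖ ^ 2) ∂μ ≠ ⊤ := by
    rw [lintegral_tsum hmeas]
    simp only [hint]
    exact hw.tsum_ofReal_ne_top
  filter_upwards [ae_lt_top' (AEMeasurable.tsum hmeas) hfin] with x hx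
  have := ENNReal.summable_toReal hx.ne
  simpa [ENNReal.toReal_ofReal] using this

end Bessel

/-! ### Absolute convergence and the Fourier expansion of the limit. -/

section Series

lemma norm_sq_eigenCoeff_le (p : ℝ) {m : ℤ} (hm : m ≠ 0) :
    ‖eigenCoeff p m‖ ^ 2 ≤ p ^ 2 * (1 / (m : ℝ) ^ 2) := by
  rcases eq_or_ne p 0 with rfl | hp
  · simp [eigenCoeff, hm]
  have hm' : 0 < |(m : ℝ)| := abs_pos.2 (by exact_mod_cast hm)
  have hp' : 0 < |p| := abs_pos.2 hp
  have h1 : ‖Complex.exp (-(2 * Real.pi * Complex.I * (m / p))) - 1‖ ≤ 2 := by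
    have h2 : ‖wave p m (-1)‖ = 1 := norm_wave _
    have h3 : wave p m (-1) = Complex.exp (-(2 * Real.pi * Complex.I * (m / p))) := by
      rw [wave]; congr 1; push_cast; ring
    rw [h3] at h2
    refine (norm_sub_le _ _).trans ?_
    rw [h2, norm_one]
    norm_num
  have h4 : ‖(-(2 * Real.pi * Complex.I * (m / p)) : ℂ)‖ = 2 * Real.pi * (|(m : ℝ)| / |p|) := by
    rw [norm_neg, norm_mul, norm_div, Complex.norm_intCast, Complex.norm_real, norm_mul, norm_mul,
      Complex.norm_I, Complex.norm_real, Real.norm_of_nonneg Real.pi_pos.le, Real.norm_eq_abs]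
    simp
  have h5 : ‖eigenCoeff p m‖ ≤ |p| / |(m : ℝ)| := by
    rw [eigenCoeff, if_neg hm, norm_div, h4, div_le_iff₀ (by positivity)]
    have h6 : |p| / |(m : ℝ)| * (2 * Real.pi * (|(m : ℝ)| / |p|)) = 2 * Real.pi := by
      field_simp
    rw [h6]
    linarith [Real.pi_gt_three]
  calc ‖eigenCoeff p m‖ ^ 2 ≤ (|p| / |(m : ℝ)|) ^ 2 := pow_le_pow_left₀ (norm_nonneg _) h5 2
    _ = p ^ 2 * (1 / (m : ℝ) ^ 2) := by rw [div_pow, sq_abs, sq_abs]; ring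

lemma summable_norm_sq_eigenCoeff (p : ℝ) : Summable fun m : ℤ => ‖eigenCoeff p m‖ ^ 2 := by
  refine Summable.of_norm_bounded_eventually
    ((Real.summable_one_div_int_pow.2 one_lt_two).mul_left (p ^ 2)) ?_
  filter_upwards [(Set.finite_singleton (0 : ℤ)).compl_mem_cofinite] with m hm
  rw [Real.norm_of_nonneg (sq_nonneg _)]
  exact norm_sq_eigenCoeff_le p hm

lemma hasSum_wave_of_summable {p : ℝ} (hp : 0 < p) {h : ℝ → ℂ} (hc : Continuous h)
    (hper : Function.Periodic h p) {c : ℤ → ℂ}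
    (hcoeff : ∀ m, (1 / p) * ∫ s in (0 : ℝ)..p, wave p m (-s) * h s = c m) (hs : Summable c)
    (t : ℝ) : HasSum (fun m => wave p m t * c m) (h t) := by
  have : Fact (0 < p) := ⟨hp⟩
  let F : C(AddCircle p, ℂ) := ⟨hper.lift, continuous_coinduced_dom.mpr hc⟩
  have hF : ∀ s : ℝ, F (s : AddCircle p) = h s := fun s => hper.lift_coe s
  have hfour : ∀ (m : ℤ) (s : ℝ), fourier m (s : AddCircle p) = wave p m s := fun m s => by
    rw [fourier_coe_apply, wave]
    congr 1
    ring
  have hFc : ∀ m, fourierCoeff F m = c m := fun m => by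
    rw [fourierCoeff_eq_intervalIntegral F m 0, zero_add, ← hcoeff, Complex.real_smul]
    push_cast
    congr 1
    refine intervalIntegral.integral_congr fun s _ => ?_
    rw [hF, hfour, smul_eq_mul]
    congr 1
    rw [wave, wave]
    congr 1
    push_cast
    ring
  have hsum := has_pointwise_sum_fourier_series_of_summable (f := F)
    (by rwa [show fourierCoeff F = c from funext hFc]) (t : AddCircle p)
  rw [hF] at hsum
  simpa only [hFc, hfour, smul_eq_mul, mul_comm] using hsum

lemma eigenCoeff_neg (p : ℝ) (m : ℤ) : eigenCoeff (-p) m = eigenCoeff p (-m) := by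
  have h : ((m : ℂ) / ((-p : ℝ) : ℂ)) = ((-m : ℤ) : ℂ) / (p : ℂ) := by
    push_cast
    rw [div_neg, neg_div]
  rw [eigenCoeff, eigenCoeff, h]
  simp only [neg_eq_zero]

lemma wave_neg_left (p : ℝ) (m : ℤ) (t : ℝ) : wave (-p) m t = wave p (-m) t := by
  rw [wave, wave]
  congr 1
  push_cast
  rw [div_neg, neg_mul, neg_div]

variable {X : Type*} [MeasurableSpace X] {μ : Measure X} {T : X ≃ᵐ X} {γ p : ℝ} {f : X → ℂ}

lemma eigenProj_neg (hT : MeasurePreserving T μ μ) (p : ℝ) (m : ℤ) (w : Lp ℂ 2 μ) :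
    eigenProj hT (-p) m w = eigenProj hT p (-m) w := by
  have h : ((m : ℂ) / ((-p : ℝ) : ℂ)) = ((-m : ℤ) : ℂ) / (p : ℂ) := by
    push_cast
    rw [div_neg, neg_div]
  have h2 : eigenspace hT (-p) m = eigenspace hT p (-m) := by
    rw [eigenspace, eigenspace, h]
  simp only [eigenProj]
  congr!

variable [IsProbabilityMeasure μ]

lemma ae_hasSum_limitFun (hT : MeasurePreserving T μ μ) (hγ : Irrational γ) (hp : 0 < p)
    (h : γ = p ∨ γ = -p) (hfm : Measurable f) (hf : MemLp f 2 μ) :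
    ∀ᵐ x ∂μ, ∀ ℓ, HasSum
      (fun m => wave p m ℓ * (eigenCoeff p m * eigenProj hT p m (hf.toLp f) x))
      (limitFun T γ f ℓ x) := by
  have hpirr : Irrational p := by
    rcases h with rfl | rfl
    · exact hγ
    · simpa using hγ.neg
  have hco : ∀ᵐ x ∂μ, ∀ m, waveCoeff T γ f p m x
      = eigenCoeff p m * eigenProj hT p m (hf.toLp f) x :=
    ae_all_iff.2 fun m => waveCoeff_ae_eq hT hγ hp h hfm hf
  filter_upwards [ae_tendsto_floorAvg hT hγ hfm hf, hco,
    ae_summable_norm_sq (summable_norm_sq_eigenProj hT hpirr (hf.toLp f))] with x h1 h2 h3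
  refine hasSum_wave_of_summable hp h1.2 (limitFun_periodic h x) h2 ?_
  -- The products are dominated through `a b ≤ a² + b²`.
  refine Summable.of_norm_bounded ((summable_norm_sq_eigenCoeff p).add h3) fun m => ?_
  rw [norm_mul]
  nlinarith [sq_nonneg (‖eigenCoeff p m‖ - ‖eigenProj hT p m (hf.toLp f) x‖),
    sq_nonneg (‖eigenCoeff p m‖), sq_nonneg (‖eigenProj hT p m (hf.toLp f) x‖)]

/-- The Fourier expansion of the limit function. -/
lemma ae_hasSum_suspLimit (hT : MeasurePreserving T μ μ) (hγ : Irrational γ)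
    (hfm : Measurable f) (hf : MemLp f 2 μ) :
    ∀ᵐ x ∂μ, ∀ ℓ, HasSum
      (fun m => wave γ m ℓ * eigenCoeff γ m * eigenProj hT γ m (hf.toLp f) x)
      (suspLimit T γ f (suspPoint T ℓ x)) := by
  rcases hγ.ne_zero.lt_or_gt with h0 | h0
  · filter_upwards [ae_hasSum_limitFun hT hγ (neg_pos.2 h0) (Or.inr (neg_neg γ).symm) hfm hf]
      with x hx ℓ
    -- For `γ < 0` the expansion has period `p = -γ`. Only the ratio `m/γ` enters, so reindexing by
    -- `m ↦ -m` gives the stated series.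
    have h1 := (Equiv.neg ℤ).hasSum_iff.2 (hx ℓ)
    change HasSum _ (limitFun T γ f ℓ x)
    convert h1 using 2 with m
    obtain ⟨q, rfl⟩ : ∃ q, γ = -q := ⟨-γ, (neg_neg γ).symm⟩
    simp only [Function.comp_apply, Equiv.neg_apply, wave_neg_left, eigenCoeff_neg, eigenProj_neg,
      neg_neg, mul_assoc]
  · filter_upwards [ae_hasSum_limitFun hT hγ h0 (Or.inl rfl) hfm hf] with x hx ℓ
    simpa only [mul_assoc, limitFun] using hx ℓ

end Series

/-! ### Independence of the measurable representative of `f`. -/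

section Congruence

variable {X : Type*} [MeasurableSpace X] {μ : Measure X} {T : X ≃ᵐ X} {γ : ℝ} {f f' : X → ℂ}

lemma suspLimit_congr {y : Susp T}
    (h : ∀ N, birkhoffAverage ℂ (suspShift T γ) (suspExt T f) N y
      = birkhoffAverage ℂ (suspShift T γ) (suspExt T f') N y) :
    suspLimit T γ f y = suspLimit T γ f' y := by
  simp only [suspLimit, h]

lemma ae_birkhoffAverage_suspPoint_eq (hT : MeasurePreserving T μ μ) (h : f =ᵐ[μ] f') :
    ∀ᵐ x ∂μ, ∀ t N, birkhoffAverage ℂ (suspShift T γ) (suspExt T f) N (suspPoint T t x)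
      = birkhoffAverage ℂ (suspShift T γ) (suspExt T f') N (suspPoint T t x) := by
  have h1 : ∀ᵐ x ∂μ, ∀ k : ℤ, f (intIter T k x) = f' (intIter T k x) :=
    ae_all_iff.2 fun k => (measurePreserving_intIter hT k).quasiMeasurePreserving.ae h
  filter_upwards [h1] with x hx t N
  simp only [birkhoffAverage_suspPoint, hx]

variable [IsProbabilityMeasure μ]

lemma suspExt_ae_eq (h : f =ᵐ[μ] f') : suspExt T f =ᵐ[suspMeasure T μ] suspExt T f' := by
  -- The disagreement set need not be measurable. The extension of the indicator of a measurable
  -- null set containing it detects where the two extensions can differ.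
  set N := toMeasurable μ {x | f x ≠ f' x}
  have hN : MeasurableSet N := measurableSet_toMeasurable _ _
  have hN0 : μ N = 0 := by rw [measure_toMeasurable]; exact h
  have hsub : ∀ x, x ∉ N → f x = f' x := fun x hx => by
    by_contra hne
    exact hx (subset_toMeasurable _ _ hne)
  have hm : Measurable (suspExt T (N.indicator 1)) :=
    measurable_suspExt T (measurable_one.indicator hN)
  have h0 : ∀ᵐ y ∂(suspMeasure T μ), suspExt T (N.indicator 1) y = 0 := by
    rw [← map_suspPoint, ae_map_iff (measurable_suspPoint T).aemeasurable
      (p := fun y => suspExt T (N.indicator 1) y = 0) (hm (measurableSet_singleton 0))]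
    have h1 : ∀ᵐ x ∂μ, x ∉ N := measure_eq_zero_iff_ae_notMem.1 hN0
    filter_upwards [suspExt_suspPoint_ae (T := T) (μ := μ) (N.indicator 1),
      Measure.quasiMeasurePreserving_snd.ae h1] with q h2 h3
    rw [h2, Set.indicator_of_notMem h3]
  filter_upwards [h0] with y hy
  obtain ⟨t, x, rfl⟩ := exists_suspPoint_eq T y
  rw [suspExt_suspPoint] at hy
  rw [suspExt_suspPoint, suspExt_suspPoint]
  refine hsub _ fun hmem => ?_
  rw [Set.indicator_of_mem hmem] at hy
  exact one_ne_zero hy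

lemma ae_birkhoffAverage_eq (hT : MeasurePreserving T μ μ) (h : f =ᵐ[μ] f') :
    ∀ᵐ y ∂(suspMeasure T μ), ∀ N, birkhoffAverage ℂ (suspShift T γ) (suspExt T f) N y
      = birkhoffAverage ℂ (suspShift T γ) (suspExt T f') N y := by
  have h1 : ∀ᵐ y ∂(suspMeasure T μ), ∀ n : ℕ,
      suspExt T f ((suspShift T γ)^[n] y) = suspExt T f' ((suspShift T γ)^[n] y) :=
    ae_all_iff.2 fun n =>
      ((measurePreserving_suspShift hT γ).iterate n).quasiMeasurePreserving.ae (suspExt_ae_eq h)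
  filter_upwards [h1] with y hy N
  simp only [birkhoffAverage, birkhoffSum, hy]

end Congruence

end IrrationalAverages
theorem corollary4p5 {X : Type*} [MeasurableSpace X] (μ : Measure X) [IsProbabilityMeasure μ]
    (T : X ≃ᵐ X) (hT : MeasurePreserving T μ μ) (γ : ℝ) (hγ : Irrational γ)
    (f : X → ℂ) (hf : MemLp f 2 μ) :
    -- the pointwise limit of the ergodic averages of `f̃` exists a.e. and is a version of
    -- the conditional expectation of `f̃` given the `S`-invariant σ-algebra
    ((∀ᵐ y ∂(suspMeasure T μ),
        Tendsto (fun N : ℕ => birkhoffAverage ℂ (suspShift T γ) (suspExt T f) N y) atTop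
          (𝓝 (suspLimit T γ f y))) ∧
      suspLimit T γ f =ᵐ[suspMeasure T μ]
        (suspMeasure T μ)[suspExt T f | MeasurableSpace.invariants (suspShift T γ)] ∧
      (Measurable f →
        Measurable[MeasurableSpace.invariants (suspShift T γ)] (suspLimit T γ f))) ∧
    -- at the points `({ℓ}, T^[ℓ] x)`
    ∀ ℓ : ℝ, ∀ᵐ x ∂μ,
      Tendsto (fun N : ℕ =>
          birkhoffAverage ℂ (suspShift T γ) (suspExt T f) N (suspPoint T ℓ x)) atTop
        (𝓝 (suspLimit T γ f (suspPoint T ℓ x))) ∧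
      HasSum (fun m : ℤ => Complex.exp (2 * Real.pi * Complex.I * (m * ℓ / γ)) *
          eigenCoeff γ m * (eigenProj hT γ m (hf.toLp f) : X → ℂ) x)
        (suspLimit T γ f (suspPoint T ℓ x)) ∧
      Tendsto (fun N : ℕ =>
          (1 / (N : ℂ)) * ∑ n ∈ Finset.range N, f (intIter T ⌊γ * n + ℓ⌋ x)) atTop
        (𝓝 (suspLimit T γ f (suspPoint T ℓ x))) := by
  -- The preceding results need a measurable function. Passing to a representative changes the
  -- averages only on null sets, and on the orbits of almost every `x` not at all, whatever `t` is.
  set f' : X → ℂ := hf.1.mk f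
  have hff' : f =ᵐ[μ] f' := hf.1.ae_eq_mk
  have hfm' : Measurable f' := hf.1.stronglyMeasurable_mk.measurable
  have hf' : MemLp f' 2 μ := hf.ae_eq hff'
  have hLp : hf.toLp f = hf'.toLp f' := (MemLp.toLp_eq_toLp_iff _ _).2 hff'
  refine ⟨⟨?_, ?_, measurable_suspLimit⟩, fun ℓ => ?_⟩
  · filter_upwards [ae_tendsto_suspLimit (γ := γ) hT hfm' hf',
      ae_birkhoffAverage_eq (γ := γ) hT hff'] with y h1 h2
    rw [suspLimit_congr h2]
    simp only [h2]
    exact h1.1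
  · filter_upwards [ae_tendsto_suspLimit (γ := γ) hT hfm' hf',
      ae_birkhoffAverage_eq (γ := γ) hT hff',
      condExp_congr_ae (m := MeasurableSpace.invariants (suspShift T γ))
        (suspExt_ae_eq (T := T) hff')] with y h1 h2 h3
    rw [suspLimit_congr h2, h1.2, h3]
  · filter_upwards [ae_tendsto_floorAvg hT hγ hfm' hf', ae_hasSum_suspLimit hT hγ hfm' hf',
      ae_birkhoffAverage_suspPoint_eq (γ := γ) hT hff'] with x h1 h2 h3
    have h4 : Tendsto (fun N : ℕ =>
          birkhoffAverage ℂ (suspShift T γ) (suspExt T f) N (suspPoint T ℓ x)) atTop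
        (𝓝 (suspLimit T γ f (suspPoint T ℓ x))) := by
      rw [suspLimit_congr (h3 ℓ)]
      simp only [h3, birkhoffAverage_suspPoint]
      exact h1.1 ℓ
    refine ⟨h4, ?_, ?_⟩
    · rw [suspLimit_congr (h3 ℓ), hLp]
      exact h2 ℓ
    · simpa only [birkhoffAverage_suspPoint] using h4
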